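/- Consider a time-slotted link with a buffer of size $Q$, at most $A\ge 1$ arriving packets and at most $S$ transmitted packets per timeslot, where $A\le S$ and $A\le Q$. The numbers of arrivals $a[n]\in\{0,\dots,A\}$ form a stationary ergodic (irreducible) Markov chain with transition probabilities $\gamma_{a,a'}$, stationary law $\phi$ and mean $\alpha=\sum_a a\,\phi_a$. Transmitting $s\in\{0,\dots,S\}$ packets costs power $P(s)$, where $P(0)=0$ and $P$ is nondecreasing and convex. The queue length evolves as $q[n+1]=q[n]-s[n]+a[n+1]$, and in a state $(q,a)$, $0\le q\le Q$, $0\le a\le A$, only the rates $s\in\mathcal S(q)=\{s:\max(q-Q+A,0)\le s\le\min(q,S)\}$ are allowed. A policy $F=\{f_{q,a}^s\}$ gives, for each state $(q,a)$, a probability distribution on $\mathcal S(q)$; it is deterministic if all $f_{q,a}^s\in\{0,1\}$, and a unichain policy if the Markov chain it induces on the states $(q,a)$ has exactly one closed communicating class. It obtains $(P_F,D_F)$, $P_F=\sum_{q,a,s}P(s)\pi(q,a)f_{q,a}^s$, $D_F=\frac1\alpha\sum_{q,a}q\,\pi(q,a)$, where $\pi$ is a stationary distribution of the induced chain (unique for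 a unichain policy). Let $\mathcal G$ be the set of all $x=(x_{q,a}^s)$ with $x_{q,a}^s\ge 0$, $x_{q,a}^s=0$ for $s\notin\mathcal S(q)$, $\sum_{q,a,s}x_{q,a}^s=1$ and $\sum_{q,a,s}\gamma_{a,a'}x_{q,a}^s\mathbf 1_{\{s=q+a'-q'\}}=\sum_s x_{q',a'}^s$ for all $q',a'$. Let $\mathcal R$ be the set of all pairs $\left(\sum P(s)x_{q,a}^s,\ \frac1\alpha\sum q\,x_{q,a}^s\right)$ with $x\in\mathcal G$, and let $$\mathcal L=\{(P^*,D^*)\in\mathcal R:\ \text{for all }(\bar P,\bar D)\in\mathcal R,\ P^*\le\bar P\text{ or }D^*\le\bar D\}$$ be the optimal delay-power tradeoff curve. A vertex of $\mathcal L$ is a point of $\mathcal L$ that is not in the relative interior of a segment with both end points in $\mathcal L$. Two vertices $(P_1,D_1)$, $(P_2,D_2)$ with $P_1<P_2$ are adjacent if the segment between them lies in $\mathcal L$. Then: (1), (2) every vertex of $\mathcal L$ is obtained by a deterministic policy whose induced Markov chain is a unichain. (3) Let $V$ and $W$ be adjacent vertices of $\mathcal L$, with $P_V<P_W$. If no point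 strictly between them is obtained by a deterministic unichain policy, then $V$ and $W$ are obtained by two deterministic unichain policies that have different transmission rates in exactly one state. In general (the degenerate case of collinear points included) there are points $V=v_0,v_1,\dots,v_n=W$ on the segment from $V$ to $W$, with strictly increasing powers, such that for each $k<n$ the points $v_k$ and $v_{k+1}$ are obtained by two deterministic unichain policies that have different transmission rates in exactly one state. -/

import Mathlib

open Set

/-- A single link over an AWGN channel: a buffer of size `Q`, at most `A` arriving and at most `S`
transmitted packets per timeslot, a stationary and ergodic finite Markov chain of arrivals on
`{0, …, A}` with transition probabilities `γ a a'` and steady-state law `φ`, and the transmission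
power `P s` for the rates `s ∈ {0, …, S}` (the values of `P` beyond `S` play no role). -/
structure AWGNLink where
  Q : ℕ
  A : ℕ
  S : ℕ
  A_pos : 0 < A
  A_le_S : A ≤ S
  A_le_Q : A ≤ Q
  γ : Matrix (Fin (A + 1)) (Fin (A + 1)) ℝ
  γ_sum : ∀ a, ∑ a', γ a a' = 1
  /-- nonnegative entries, and every arrival state is reachable from every other one -/
  γ_irreducible : γ.IsIrreducible
  φ : Fin (A + 1) → ℝ
  φ_nonneg : ∀ a, 0 ≤ φ a
  φ_sum : ∑ a, φ a = 1
  φ_stationary : ∀ a', ∑ a, φ a * γ a a' = φ a'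
  P : ℕ → ℝ
  P_zero : P 0 = 0
  P_mono : ∀ s, s + 1 ≤ S → P s ≤ P (s + 1)
  P_convex : ∀ s, s + 2 ≤ S → 2 * P (s + 1) ≤ P s + P (s + 2)

namespace AWGNLink

/-- System states `(q, a)`: queue length and number of arrivals. -/
abbrev State (M : AWGNLink) : Type := Fin (M.Q + 1) × Fin (M.A + 1)

/-- Transmission rates. -/
abbrev Rate (M : AWGNLink) : Type := Fin (M.S + 1)

/-- Expected number of arrivals per timeslot. -/
noncomputable def α (M : AWGNLink) : ℝ := ∑ a : Fin (M.A + 1), (a : ℝ) * M.φ a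

/-- `s ∈ 𝒮(q)`, i.e. `max (q - Q + A) 0 ≤ s ≤ min q S`: neither underflow nor overflow. -/
def Feasible (M : AWGNLink) (q : Fin (M.Q + 1)) (s : M.Rate) : Prop :=
  (s : ℕ) ≤ (q : ℕ) ∧ (q : ℕ) + M.A ≤ M.Q + (s : ℕ)

/-- A (randomized, stationary) transmission policy: `f (q, a) s` is the probability of
transmitting `s` packets in state `(q, a)`. -/
structure Policy (M : AWGNLink) where
  f : M.State → M.Rate → ℝ
  nonneg : ∀ i s, 0 ≤ f i s
  sum_one : ∀ i, ∑ s, f i s = 1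
  feasible : ∀ i s, ¬ M.Feasible i.1 s → f i s = 0

/-- State-action frequencies `x (q, a) s`: the polytope `𝒢` given by the balance equations,
normalization and nonnegativity, with only feasible rates in use. -/
def frequencies (M : AWGNLink) : Set (M.State → M.Rate → ℝ) :=
  {x | (∀ j : M.State,
          ∑ i : M.State, ∑ s : M.Rate,
            M.γ i.2 j.2 * x i s *
              (if (s : ℕ) + (j.1 : ℕ) = (i.1 : ℕ) + (j.2 : ℕ) then 1 else 0)
            = ∑ s : M.Rate, x j s) ∧
       ∑ i : M.State, ∑ s : M.Rate, x i s = 1 ∧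
       (∀ i s, 0 ≤ x i s) ∧
       ∀ i s, ¬ M.Feasible i.1 s → x i s = 0}

/-- Average power of state-action frequencies. -/
noncomputable def power (M : AWGNLink) (x : M.State → M.Rate → ℝ) : ℝ :=
  ∑ i : M.State, ∑ s : M.Rate, M.P (s : ℕ) * x i s

/-- Average delay of state-action frequencies (by Little's law). -/
noncomputable def delay (M : AWGNLink) (x : M.State → M.Rate → ℝ) : ℝ :=
  1 / M.α * ∑ i : M.State, ∑ s : M.Rate, (i.1 : ℝ) * x i s

/-- The set `ℛ` of obtainable (power, delay) pairs. -/
def obtainable (M : AWGNLink) : Set (ℝ × ℝ) :=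
  {z | ∃ x ∈ M.frequencies, z = (M.power x, M.delay x)}

/-- The optimal delay-power tradeoff curve `ℒ`. -/
def curve (M : AWGNLink) : Set (ℝ × ℝ) :=
  {z | z ∈ M.obtainable ∧ ∀ w ∈ M.obtainable, z.1 ≤ w.1 ∨ z.2 ≤ w.2}

/-- The vertices of `ℒ`: its points that are not interior to a segment between two points of
`ℒ`, that is, the end points and the corners of the curve. -/
def vertices (M : AWGNLink) : Set (ℝ × ℝ) := M.curve.extremePoints ℝ

namespace Policy

variable {M : AWGNLink}

/-- Transition probabilities of the Markov chain induced by a policy: from `(q, a)` to `(q', a')`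
with `q' = q - s + a'`. -/
def trans (F : M.Policy) (i j : M.State) : ℝ :=
  M.γ i.2 j.2 *
    ∑ s : M.Rate, if (s : ℕ) + (j.1 : ℕ) = (i.1 : ℕ) + (j.2 : ℕ) then F.f i s else 0

/-- `j` is accessible from `i`. -/
def Reaches (F : M.Policy) : M.State → M.State → Prop :=
  Relation.ReflTransGen fun i j => 0 < F.trans i j

/-- A closed communicating class of the induced Markov chain. -/
def IsClosedClass (F : M.Policy) (C : Set M.State) : Prop :=
  C.Nonempty ∧ (∀ i ∈ C, ∀ j, 0 < F.trans i j → j ∈ C) ∧ ∀ i ∈ C, ∀ j ∈ C, F.Reaches i j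

/-- The induced Markov chain has exactly one closed communicating class. -/
def IsUnichain (F : M.Policy) : Prop := ∃! C : Set M.State, F.IsClosedClass C

/-- The policy selects one rate in each state. -/
def IsDeterministic (F : M.Policy) : Prop := ∀ i s, F.f i s = 0 ∨ F.f i s = 1

/-- `π` is a steady-state distribution of the induced Markov chain. -/
def IsStationary (F : M.Policy) (π : M.State → ℝ) : Prop :=
  (∀ i, 0 ≤ π i) ∧ ∑ i, π i = 1 ∧ ∀ j, ∑ i, π i * F.trans i j = π j

/-- The policy obtains the (power, delay) pair `z = (P_F, D_F)` in steady state. For a unichain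
the steady-state distribution, hence the pair, is unique. -/
def Obtains (F : M.Policy) (z : ℝ × ℝ) : Prop :=
  ∃ π : M.State → ℝ, F.IsStationary π ∧
    z.1 = ∑ i : M.State, ∑ s : M.Rate, M.P (s : ℕ) * (π i * F.f i s) ∧
    z.2 = 1 / M.α * ∑ i : M.State, (i.1 : ℝ) * π i

end Policy

/-- The pairs `z` and `w` are obtained by two deterministic policies with unichains that have
different transmission rates in exactly one state. -/
def OneStateStep (M : AWGNLink) (z w : ℝ × ℝ) : Prop :=
  ∃ F F' : M.Policy,
    F.IsDeterministic ∧ F.IsUnichain ∧ F.Obtains z ∧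
    F'.IsDeterministic ∧ F'.IsUnichain ∧ F'.Obtains w ∧
    ∃! i : M.State, F.f i ≠ F'.f i

end AWGNLink

/-! ### Finite Markov chains -/

namespace FiniteChain

/-! The curve is a face of the convex set of obtainable pairs, so its vertices are extreme points of
that set. Frequencies `x` over an extreme point can be replaced by any frequencies with smaller
support (`eq_of_support_subset`). Choosing one rate in the support of `x` in each state gives a
deterministic policy that cannot leave the support. One of its closed classes is kept, and the rates
elsewhere are redirected so that this class is reached from everywhere
(`exists_selector_of_extreme`). That this is possible rests on `Absorbing.meet`.

An edge from `z` to `w` lies on a supporting line, so its points minimize a weighted cost `d * power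
+ p * delay`. Both weights are positive: the edge is not horizontal because minimal delay determines
the power (`power_eq_of_min_delay`). The average-cost optimality equation for this weight has a
solution convex in the queue length (`exists_isBellman`), obtained from discounted problems by
letting the discount tend to one. Convexity makes the smallest and the largest optimal rates
monotone in the queue, and likewise the remaining queues (`exists_min_rates`, `exists_max_rates`).
Every policy with this monotonicity is a unichain (`IsMonotoneOptimal.isUnichain`) and obtains a
point of the edge.

From the smallest optimal rates one can pass to the largest by raising one rate by one at a time
within monotone optimal policies (`IsMonotoneOptimal.exists_raise`). A coupling (`mean_queue_le`)
shows that the delay never increases on the way, that the smallest rates obtain `z` and that the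
largest obtain `w`. Dropping the steps that do not move the point gives the chain. If no
deterministic unichain policy obtains an interior point, the first point after `z` must be `w`. -/

theorem abs_invariant {X : Type*} [Fintype X] {p : X → X → ℝ} (hp : ∀ i j, 0 ≤ p i j)
    (h1 : ∀ i, ∑ j, p i j = 1) {v : X → ℝ} (hv : ∀ j, ∑ i, v i * p i j = v j) (j : X) :
    ∑ i, |v i| * p i j = |v j| := by
  -- The triangle inequality in each coordinate; as rows sum to one, both sides have the same total,
  -- so every inequality is an equality.
  have hle : ∀ j ∈ Finset.univ, |v j| ≤ ∑ i, |v i| * p i j := by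
    intro j _
    rw [← hv j]
    refine (Finset.abs_sum_le_sum_abs _ _).trans (le_of_eq ?_)
    exact Finset.sum_congr rfl fun i _ => by rw [abs_mul, abs_of_nonneg (hp i j)]
  have heq : ∑ j, |v j| = ∑ j, ∑ i, |v i| * p i j := by
    rw [Finset.sum_comm]
    exact Finset.sum_congr rfl fun i _ => by rw [← Finset.mul_sum, h1, mul_one]
  exact ((Finset.sum_eq_sum_iff_of_le hle).1 heq j (Finset.mem_univ j)).symm

/-- The matrix `p - 1` kills constants, hence is singular and has a left null vector; the absolute
values of its entries are again invariant and can be normalized. -/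
theorem exists_stationary {X : Type*} [Fintype X] [Nonempty X] {p : X → X → ℝ}
    (hp : ∀ i j, 0 ≤ p i j) (h1 : ∀ i, ∑ j, p i j = 1) :
    ∃ v : X → ℝ, (∀ i, 0 ≤ v i) ∧ ∑ i, v i = 1 ∧ ∀ j, ∑ i, v i * p i j = v j := by
  classical
  let N : Matrix X X ℝ := Matrix.of p - 1
  have hdet : N.det = 0 := by
    rw [← Matrix.exists_mulVec_eq_zero_iff]
    refine ⟨fun _ => 1, fun h => one_ne_zero (congrFun h (Classical.arbitrary X)), ?_⟩
    ext i
    simp [N, Matrix.mulVec, dotProduct, h1, Matrix.one_apply]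
  obtain ⟨v, hv0, hv⟩ := Matrix.exists_vecMul_eq_zero_iff.2 hdet
  have hinv : ∀ j, ∑ i, v i * p i j = v j := by
    intro j
    have := congrFun hv j
    simp only [N, Matrix.vecMul_sub, Matrix.vecMul_one, Pi.sub_apply, Pi.zero_apply] at this
    simpa [Matrix.vecMul, dotProduct] using sub_eq_zero.1 this
  have hpos : 0 < ∑ i, |v i| := by
    obtain ⟨i, hi⟩ := Function.ne_iff.1 hv0
    exact Finset.sum_pos' (fun i _ => abs_nonneg _) ⟨i, Finset.mem_univ i, abs_pos.2 hi⟩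
  refine ⟨fun i => |v i| / ∑ i, |v i|, fun i => by positivity, ?_, fun j => ?_⟩
  · rw [← Finset.sum_div, div_self hpos.ne']
  · simp only
    rw [← abs_invariant hp h1 hinv j, Finset.sum_div]
    exact Finset.sum_congr rfl fun i _ => by ring

theorem pos_of_invariant {X : Type*} [Fintype X] {p : X → X → ℝ} (hp : ∀ i j, 0 ≤ p i j)
    {v : X → ℝ} (hv0 : ∀ i, 0 ≤ v i) (hv : ∀ j, ∑ i, v i * p i j = v j) {i j : X}
    (hi : 0 < v i) (hij : 0 < p i j) : 0 < v j := by
  rw [← hv j]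
  exact Finset.sum_pos' (fun k _ => mul_nonneg (hv0 k) (hp k j))
    ⟨i, Finset.mem_univ i, mul_pos hi hij⟩

/-- The positive and negative parts of `v - w` are both invariant, so their supports are closed and
disjoint. As `v - w` has sum zero, neither is empty unless `v = w`. -/
theorem stationary_unique {X : Type*} [Fintype X] {p : X → X → ℝ} (hp : ∀ i j, 0 ≤ p i j)
    (h1 : ∀ i, ∑ j, p i j = 1)
    (hmeet : ∀ C D : Set X, C.Nonempty → D.Nonempty → (∀ i ∈ C, ∀ j, 0 < p i j → j ∈ C) →
      (∀ i ∈ D, ∀ j, 0 < p i j → j ∈ D) → (C ∩ D).Nonempty)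
    {v w : X → ℝ} (hv1 : ∑ i, v i = 1) (hw1 : ∑ i, w i = 1)
    (hv : ∀ j, ∑ i, v i * p i j = v j) (hw : ∀ j, ∑ i, w i * p i j = w j) : v = w := by
  by_contra hne
  have hd : ∀ j, ∑ i, (v i - w i) * p i j = v j - w j := by
    intro j
    simp only [sub_mul, Finset.sum_sub_distrib, hv, hw]
  have ha := abs_invariant hp h1 (v := fun i => v i - w i) hd
  have hsum : ∑ i, (v i - w i) = 0 := by rw [Finset.sum_sub_distrib, hv1, hw1, sub_self]
  obtain ⟨k, hk⟩ := Function.ne_iff.1 hne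
  have hpos : ∃ i ∈ Finset.univ, 0 < v i - w i :=
    Finset.exists_pos_of_sum_zero_of_exists_nonzero _ hsum ⟨k, Finset.mem_univ k, sub_ne_zero.2 hk⟩
  have hneg : ∃ i ∈ Finset.univ, 0 < w i - v i := by
    refine Finset.exists_pos_of_sum_zero_of_exists_nonzero _ ?_
      ⟨k, Finset.mem_univ k, sub_ne_zero.2 (Ne.symm hk)⟩
    rw [Finset.sum_sub_distrib, hv1, hw1, sub_self]
  have hP : ∀ j, ∑ i, (|v i - w i| + (v i - w i)) * p i j = |v j - w j| + (v j - w j) := by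
    intro j
    simp only [add_mul, Finset.sum_add_distrib, ha, hd]
  have hN : ∀ j, ∑ i, (|v i - w i| - (v i - w i)) * p i j = |v j - w j| - (v j - w j) := by
    intro j
    simp only [sub_mul _ (_ - _), Finset.sum_sub_distrib, ha, hd]
  obtain ⟨i, hi1, hi2⟩ := hmeet {i | 0 < |v i - w i| + (v i - w i)}
    {i | 0 < |v i - w i| - (v i - w i)}
    (by
      obtain ⟨i, -, hi⟩ := hpos
      exact ⟨i, by simp only [mem_ofPred_eq]; linarith [le_abs_self (v i - w i)]⟩)
    (by
      obtain ⟨i, -, hi⟩ := hneg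
      exact ⟨i, by simp only [mem_ofPred_eq]; linarith [abs_nonneg (v i - w i)]⟩)
    (fun i hi j hij => pos_of_invariant hp
      (fun i => by linarith [neg_abs_le (v i - w i)]) hP hi hij)
    (fun i hi j hij => pos_of_invariant hp
      (fun i => by linarith [le_abs_self (v i - w i)]) hN hi hij)
  simp only [mem_ofPred_eq] at hi1 hi2
  rcases abs_cases (v i - w i) with h | h <;> linarith

/-- A minimal nonempty closed subset works: the points reachable from one of its elements form a
closed subset, hence all of it. -/
theorem exists_communicating {X : Type*} [Finite X] (r : X → X → Prop) {C : Set X}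
    (hne : C.Nonempty) (hC : ∀ i ∈ C, ∀ j, r i j → j ∈ C) :
    ∃ B ⊆ C, B.Nonempty ∧ (∀ i ∈ B, ∀ j, r i j → j ∈ B) ∧
      ∀ i ∈ B, ∀ j ∈ B, Relation.ReflTransGen r i j := by
  obtain ⟨B, hBC, hB⟩ := (Set.toFinite {B : Set X | B.Nonempty ∧ ∀ i ∈ B, ∀ j, r i j → j ∈ B}
    ).exists_le_minimal (a := C) ⟨hne, hC⟩
  refine ⟨B, hBC, hB.1.1, hB.1.2, fun i hi j hj => ?_⟩
  refine hB.2 (y := {k | k ∈ B ∧ Relation.ReflTransGen r i k}) ⟨⟨i, hi, .refl⟩, ?_⟩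
    (fun k hk => hk.1) hj |>.2
  exact fun k hk l hkl => ⟨hB.1.2 k hk.1 l hkl, hk.2.tail hkl⟩

end FiniteChain

namespace AWGNLink

/-! ### Arrivals and one-step dynamics -/

theorem γ_nonneg (M : AWGNLink) (a a' : Fin (M.A + 1)) : 0 ≤ M.γ a a' :=
  M.γ_irreducible.nonneg a a'

theorem exists_γ_pos (M : AWGNLink) (a : Fin (M.A + 1)) : ∃ a', 0 < M.γ a a' := by
  by_contra! h
  have := M.γ_sum a
  have h2 : ∑ a', M.γ a a' ≤ 0 := Finset.sum_nonpos fun a' _ => h a'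
  linarith

theorem mem_of_arrivals_closed (M : AWGNLink) {B : Set (Fin (M.A + 1))} (hne : B.Nonempty)
    (hB : ∀ a ∈ B, ∀ a', 0 < M.γ a a' → a' ∈ B) (a : Fin (M.A + 1)) : a ∈ B := by
  obtain ⟨b, hb⟩ := hne
  let : Quiver (Fin (M.A + 1)) := M.γ.toQuiver
  obtain ⟨p, -⟩ := M.γ_irreducible.connected b a
  induction p with
  | nil => exact hb
  | cons _ e ih => exact hB _ ih _ e.down

theorem φ_pos (M : AWGNLink) (a : Fin (M.A + 1)) : 0 < M.φ a := by
  refine M.mem_of_arrivals_closed (B := {a | 0 < M.φ a}) ?_ ?_ a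
  · by_contra h
    have h2 : ∑ a, M.φ a ≤ 0 := Finset.sum_nonpos fun a _ => not_lt.1 fun ha => h ⟨a, ha⟩
    linarith [M.φ_sum]
  · exact fun a ha a' h =>
      FiniteChain.pos_of_invariant M.γ_nonneg M.φ_nonneg M.φ_stationary ha h

theorem α_pos (M : AWGNLink) : 0 < M.α :=
  Finset.sum_pos' (fun a _ => mul_nonneg (Nat.cast_nonneg _) (M.φ_nonneg a))
    ⟨Fin.last _, Finset.mem_univ _, mul_pos (by simpa using M.A_pos) (M.φ_pos _)⟩

/-- The arrival law is the only one invariant under `γ`. -/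
theorem eq_φ_of_invariant (M : AWGNLink) {ψ : Fin (M.A + 1) → ℝ} (h1 : ∑ a, ψ a = 1)
    (h : ∀ a', ∑ a, ψ a * M.γ a a' = ψ a') : ψ = M.φ := by
  refine FiniteChain.stationary_unique M.γ_nonneg M.γ_sum ?_ h1 M.φ_sum h M.φ_stationary
  intro C D hC hD hC' hD'
  exact ⟨0, M.mem_of_arrivals_closed hC hC' 0, M.mem_of_arrivals_closed hD hD' 0⟩

/-- The state with queue length `q`, truncated at `Q`. -/
def st (M : AWGNLink) (q : ℕ) (a : Fin (M.A + 1)) : M.State := (⟨min q M.Q, by omega⟩, a)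

/-- The state after transmitting `s` packets in state `i`, with `a'` arrivals. -/
def next (M : AWGNLink) (i : M.State) (s : M.Rate) (a' : Fin (M.A + 1)) : M.State :=
  M.st (i.1 - s + a') a'

@[simp] theorem st_snd (M : AWGNLink) (q : ℕ) (a : Fin (M.A + 1)) : (M.st q a).2 = a := rfl

@[simp] theorem next_snd (M : AWGNLink) (i : M.State) (s : M.Rate) (a' : Fin (M.A + 1)) :
    (M.next i s a').2 = a' := rfl

theorem st_fst (M : AWGNLink) {q : ℕ} (hq : q ≤ M.Q) (a : Fin (M.A + 1)) :
    ((M.st q a).1 : ℕ) = q := by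
  simp [st, hq]

theorem next_fst (M : AWGNLink) {i : M.State} {s : M.Rate} (h : M.Feasible i.1 s)
    (a' : Fin (M.A + 1)) : ((M.next i s a').1 : ℕ) = i.1 - s + a' := by
  have := h.1
  have := h.2
  have := a'.2
  exact M.st_fst (by omega) a'

theorem state_ext (M : AWGNLink) {i j : M.State} (h1 : (i.1 : ℕ) = j.1) (h2 : i.2 = j.2) :
    i = j := Prod.ext (Fin.ext h1) h2

/-- Expectation of `f` at the next state. -/
noncomputable def expect (M : AWGNLink) (f : M.State → ℝ) (i : M.State) (s : M.Rate) : ℝ :=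
  ∑ a', M.γ i.2 a' * f (M.next i s a')

theorem expect_mono (M : AWGNLink) {f g : M.State → ℝ} (h : ∀ i, f i ≤ g i) (i : M.State)
    (s : M.Rate) : M.expect f i s ≤ M.expect g i s :=
  Finset.sum_le_sum fun _ _ => mul_le_mul_of_nonneg_left (h _) (M.γ_nonneg _ _)

theorem expect_affine (M : AWGNLink) (f : M.State → ℝ) (b c : ℝ) (i : M.State) (s : M.Rate) :
    M.expect (fun j => b * f j + c) i s = b * M.expect f i s + c := by
  simp only [expect, mul_add, Finset.sum_add_distrib, ← Finset.sum_mul, M.γ_sum, one_mul,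
    Finset.mul_sum]
  congr 1
  exact Finset.sum_congr rfl fun a _ => by ring

theorem expect_const (M : AWGNLink) (c : ℝ) (i : M.State) (s : M.Rate) :
    M.expect (fun _ => c) i s = c := by
  simp only [expect, ← Finset.sum_mul, M.γ_sum, one_mul]

/-- For each arrival the indicator singles out one queue length; feasibility keeps it within the
buffer, so the truncation in `st` has no effect. -/
theorem sum_kernel (M : AWGNLink) {i : M.State} {s : M.Rate} (h : M.Feasible i.1 s)
    (f : M.State → ℝ) :
    ∑ j : M.State, M.γ i.2 j.2 *
      (if (s : ℕ) + (j.1 : ℕ) = (i.1 : ℕ) + (j.2 : ℕ) then 1 else 0) * f j = M.expect f i s := by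
  rw [Fintype.sum_prod_type_right]
  refine Finset.sum_congr rfl fun a' _ => ?_
  rw [Finset.sum_eq_single (M.next i s a').1]
  · rw [if_pos, mul_one]
    · rfl
    · have := M.next_fst h a'
      have := h.1
      simp only
      omega
  · intro q _ hq
    rw [if_neg, mul_zero, zero_mul]
    intro h2
    apply hq
    ext
    rw [M.next_fst h a']
    have := h.1
    simp only at h2
    omega
  · simp

/-! ### Deterministic policies -/

/-- A choice of one feasible rate in each state. -/
def IsSelector (M : AWGNLink) (σ : M.State → M.Rate) : Prop := ∀ i, M.Feasible i.1 (σ i)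

/-- The deterministic policy with the rates `σ`. -/
noncomputable def detPolicy (M : AWGNLink) (σ : M.State → M.Rate) (hσ : M.IsSelector σ) :
    M.Policy where
  f i s := if s = σ i then 1 else 0
  nonneg i s := by split_ifs <;> norm_num
  sum_one i := by simp
  feasible i s h := if_neg fun hs : s = σ i => h (hs ▸ hσ i)

/-- `C` is closed under the dynamics of the selector `σ`. -/
def Absorbing (M : AWGNLink) (σ : M.State → M.Rate) (C : Set M.State) : Prop :=
  ∀ i ∈ C, ∀ a', 0 < M.γ i.2 a' → M.next i (σ i) a' ∈ C

variable {M : AWGNLink} {σ : M.State → M.Rate}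

theorem detPolicy_isDeterministic (hσ : M.IsSelector σ) :
    (M.detPolicy σ hσ).IsDeterministic := by
  intro i s
  simp only [detPolicy]
  split_ifs <;> simp

theorem detPolicy_trans (hσ : M.IsSelector σ) (i j : M.State) :
    (M.detPolicy σ hσ).trans i j = M.γ i.2 j.2 *
      (if (σ i : ℕ) + (j.1 : ℕ) = (i.1 : ℕ) + (j.2 : ℕ) then 1 else 0) := by
  simp only [Policy.trans, detPolicy]
  congr 1
  rw [Finset.sum_eq_single (σ i)]
  · simp
  · intro s _ hs
    simp [hs]
  · simp

theorem detPolicy_trans_pos (hσ : M.IsSelector σ) {i j : M.State} :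
    0 < (M.detPolicy σ hσ).trans i j ↔ 0 < M.γ i.2 j.2 ∧ j = M.next i (σ i) j.2 := by
  have h1 := (hσ i).1
  have h2 := M.next_fst (hσ i) j.2
  rw [detPolicy_trans]
  split_ifs with h
  · rw [mul_one]
    exact ⟨fun hp => ⟨hp, M.state_ext (by omega) rfl⟩, fun hp => hp.1⟩
  · rw [mul_zero]
    refine ⟨fun hp => (lt_irrefl _ hp).elim, fun hp => (h ?_).elim⟩
    have := congrArg (fun k : M.State => (k.1 : ℕ)) hp.2
    omega

theorem absorbing_iff (hσ : M.IsSelector σ) {C : Set M.State} :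
    (∀ i ∈ C, ∀ j, 0 < (M.detPolicy σ hσ).trans i j → j ∈ C) ↔ M.Absorbing σ C := by
  constructor
  · intro h i hi a' ha
    exact h i hi _ ((detPolicy_trans_pos hσ).2 ⟨ha, rfl⟩)
  · intro h i hi j hj
    obtain ⟨h1, h2⟩ := (detPolicy_trans_pos hσ).1 hj
    rw [h2]
    exact h i hi _ h1

theorem Policy.trans_nonneg (F : M.Policy) (i j : M.State) : 0 ≤ F.trans i j :=
  mul_nonneg (M.γ_nonneg _ _) (Finset.sum_nonneg fun s _ => by
    split_ifs
    exacts [F.nonneg i s, le_rfl])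

theorem Policy.sum_trans (F : M.Policy) (i : M.State) (f : M.State → ℝ) :
    ∑ j, F.trans i j * f j = ∑ s, F.f i s * M.expect f i s := by
  have h : ∀ j, F.trans i j * f j = ∑ s : M.Rate, F.f i s * (M.γ i.2 j.2 *
      (if (s : ℕ) + (j.1 : ℕ) = (i.1 : ℕ) + (j.2 : ℕ) then 1 else 0) * f j) := by
    intro j
    rw [Policy.trans, Finset.mul_sum, Finset.sum_mul]
    refine Finset.sum_congr rfl fun s _ => ?_
    split_ifs <;> ring
  simp only [h]
  rw [Finset.sum_comm]
  refine Finset.sum_congr rfl fun s _ => ?_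
  rw [← Finset.mul_sum]
  by_cases hs : M.Feasible i.1 s
  · rw [M.sum_kernel hs]
  · rw [F.feasible i s hs, zero_mul, zero_mul]

theorem Policy.sum_trans_eq_one (F : M.Policy) (i : M.State) : ∑ j, F.trans i j = 1 := by
  have := F.sum_trans i (fun _ => 1)
  simpa only [mul_one, expect_const, F.sum_one] using this

theorem detPolicy_sum_trans (hσ : M.IsSelector σ) (i : M.State) (f : M.State → ℝ) :
    ∑ j, (M.detPolicy σ hσ).trans i j * f j = M.expect f i (σ i) := by
  rw [Policy.sum_trans]
  simp [detPolicy]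

/-- Stationarity tested against functions. -/
theorem detPolicy_isStationary_iff (hσ : M.IsSelector σ) {π : M.State → ℝ} :
    (M.detPolicy σ hσ).IsStationary π ↔ (∀ i, 0 ≤ π i) ∧ ∑ i, π i = 1 ∧
      ∀ f : M.State → ℝ, ∑ i, π i * M.expect f i (σ i) = ∑ i, π i * f i := by
  refine and_congr_right fun _ => and_congr_right fun _ => ⟨fun h f => ?_, fun h j => ?_⟩
  · simp only [← detPolicy_sum_trans hσ, Finset.mul_sum]
    rw [Finset.sum_comm]
    refine Finset.sum_congr rfl fun j _ => ?_
    rw [← h j, Finset.sum_mul]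
    exact Finset.sum_congr rfl fun i _ => by ring
  · have := h (fun k => if k = j then 1 else 0)
    simp only [← detPolicy_sum_trans hσ] at this
    simpa using this

/-- Two closed communicating classes that share a state coincide, so it is enough that closed sets
always intersect. -/
theorem Policy.isUnichain_of_meet (F : M.Policy)
    (h : ∀ C D : Set M.State, C.Nonempty → D.Nonempty → (∀ i ∈ C, ∀ j, 0 < F.trans i j → j ∈ C) →
      (∀ i ∈ D, ∀ j, 0 < F.trans i j → j ∈ D) → (C ∩ D).Nonempty) : F.IsUnichain := by
  obtain ⟨B, -, hB1, hB2, hB3⟩ := FiniteChain.exists_communicating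
    (fun i j => 0 < F.trans i j) (C := univ) ⟨M.st 0 0, mem_univ _⟩ (fun _ _ _ _ => mem_univ _)
  have key : ∀ C D : Set M.State, F.IsClosedClass C → F.IsClosedClass D → C ⊆ D := by
    intro C D hC hD i hi
    obtain ⟨k, hk, hk'⟩ := h C D hC.1 hD.1 hC.2.1 hD.2.1
    have hki : Relation.ReflTransGen (fun i j => 0 < F.trans i j) k i := hC.2.2 k hk i hi
    clear hi
    induction hki with
    | refl => exact hk'
    | tail _ h2 ih => exact hD.2.1 _ ih _ h2
  exact ⟨B, ⟨hB1, hB2, hB3⟩, fun C hC => (key C B hC ⟨hB1, hB2, hB3⟩).antisymm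
    (key B C ⟨hB1, hB2, hB3⟩ hC)⟩

theorem Policy.IsUnichain.meet {F : M.Policy} (hF : F.IsUnichain) (C D : Set M.State)
    (hC : C.Nonempty) (hD : D.Nonempty) (hC' : ∀ i ∈ C, ∀ j, 0 < F.trans i j → j ∈ C)
    (hD' : ∀ i ∈ D, ∀ j, 0 < F.trans i j → j ∈ D) : (C ∩ D).Nonempty := by
  obtain ⟨B, hBC, hB⟩ := FiniteChain.exists_communicating (fun i j => 0 < F.trans i j) hC hC'
  obtain ⟨B', hBD, hB'⟩ := FiniteChain.exists_communicating (fun i j => 0 < F.trans i j) hD hD'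
  have : B = B' := hF.unique hB hB'
  obtain ⟨i, hi⟩ := hB.1
  exact ⟨i, hBC hi, hBD (this ▸ hi)⟩

theorem Policy.IsUnichain.stationary_unique {F : M.Policy} (hF : F.IsUnichain)
    {π π' : M.State → ℝ} (h : F.IsStationary π) (h' : F.IsStationary π') : π = π' :=
  FiniteChain.stationary_unique F.trans_nonneg F.sum_trans_eq_one hF.meet h.2.1 h'.2.1 h.2.2 h'.2.2

end AWGNLink

namespace AWGNLink

variable {M : AWGNLink} {σ : M.State → M.Rate}

/-! ### Accessibility -/

theorem exists_arrival_ne (M : AWGNLink) (b : Fin (M.A + 1)) :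
    ∃ a a', 0 < M.γ a a' ∧ a' ≠ b := by
  by_contra! h
  have h1 : ∀ a, a ∈ ({b} : Set (Fin (M.A + 1))) :=
    M.mem_of_arrivals_closed ⟨b, rfl⟩ fun a _ a' ha => h a a' ha
  have h2 : (0 : Fin (M.A + 1)) = Fin.last M.A := (h1 0).trans (h1 _).symm
  have h3 := congrArg Fin.val h2
  simp only [Fin.val_zero, Fin.val_last] at h3
  have := M.A_pos
  omega

theorem Absorbing.exists_mem {C : Set M.State} (h : M.Absorbing σ C) (hne : C.Nonempty)
    (a : Fin (M.A + 1)) : ∃ i ∈ C, i.2 = a := by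
  obtain ⟨i, hi⟩ := hne
  refine M.mem_of_arrivals_closed (B := {a | ∃ i ∈ C, i.2 = a}) ⟨i.2, i, hi, rfl⟩ ?_ a
  rintro _ ⟨i, hi, rfl⟩ a' ha
  exact ⟨_, h i hi a' ha, rfl⟩

theorem exists_isSelector (M : AWGNLink) : ∃ σ, M.IsSelector σ := by
  refine ⟨fun i => ⟨min i.1 M.S, by omega⟩, fun i => ⟨?_, ?_⟩⟩ <;>
  · have := M.A_le_S
    have := M.A_le_Q
    have := i.1.2
    simp only
    omega

/-- A set that some selector cannot leave meets every set that no rate leaves. -/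
theorem Absorbing.meet (hσ : M.IsSelector σ) {B D : Set M.State} (hBσ : M.Absorbing σ B)
    (hB : B.Nonempty) (hD : D.Nonempty)
    (hD' : ∀ i ∈ D, ∀ s, M.Feasible i.1 s → ∀ a', 0 < M.γ i.2 a' → M.next i s a' ∈ D) :
    (B ∩ D).Nonempty := by
  classical
  by_contra hdisj
  have hdisj' : ∀ i ∈ B, i ∉ D := fun i hi hi' => hdisj ⟨i, hi, hi'⟩
  have hDσ : M.Absorbing σ D := fun i hi a' => hD' i hi _ (hσ i) a'
  -- Both sets contain states with every arrival number, so their distance in the queue at equal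
  -- arrivals makes sense; let `d` be its minimum.
  have hex : ∃ n : ℕ, ∃ i ∈ B, ∃ j ∈ D, i.2 = j.2 ∧
      ((j.1 : ℕ) = i.1 + n ∨ (i.1 : ℕ) = j.1 + n) := by
    obtain ⟨i, hi, hi0⟩ := hBσ.exists_mem hB 0
    obtain ⟨j, hj, hj0⟩ := hDσ.exists_mem hD 0
    rcases le_total (i.1 : ℕ) j.1 with h | h
    · exact ⟨j.1 - i.1, i, hi, j, hj, hi0.trans hj0.symm, Or.inl (by omega)⟩
    · exact ⟨i.1 - j.1, i, hi, j, hj, hi0.trans hj0.symm, Or.inr (by omega)⟩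
  set d := Nat.find hex with hd
  have hmin : ∀ n : ℕ, ∀ i ∈ B, ∀ j ∈ D, i.2 = j.2 →
      ((j.1 : ℕ) = i.1 + n ∨ (i.1 : ℕ) = j.1 + n) → d ≤ n :=
    fun n i hi j hj h1 h2 => Nat.find_min' hex ⟨i, hi, j, hj, h1, h2⟩
  have hdpos : 0 < d := by
    refine Nat.pos_of_ne_zero fun h0 => ?_
    obtain ⟨i, hi, j, hj, h1, h2⟩ := Nat.find_spec hex
    rw [← hd, h0] at h2
    have : i = j := M.state_ext (by omega) h1
    exact hdisj' i hi (this ▸ hj)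
  have hAS := M.A_le_S
  have hAQ := M.A_le_Q
  obtain ⟨i, hi, j, hj, hij, h | h⟩ := Nat.find_spec hex
  · rw [← hd] at h
    let T : Set M.State := {i | i ∈ B ∧ ∃ j ∈ D, i.2 = j.2 ∧ (j.1 : ℕ) = i.1 + d}
    have hT : ∀ i ∈ T, (σ i : ℕ) = M.S ∧ ∀ a', 0 < M.γ i.2 a' → M.next i (σ i) a' ∈ T := by
      rintro i ⟨hi, j, hj, hij, h⟩
      obtain ⟨hf1, hf2⟩ := hσ i
      have hjQ := j.1.2
      have hsS := (σ i).2
      -- The upper state `j` may use any feasible rate. If it can leave the same remainder as `σ`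
      -- leaves in `i`, both move to a common state, which is excluded. Otherwise it transmits `S`,
      -- and minimality of `d` forces `σ i = S`.
      by_cases hc : (j.1 : ℕ) - (i.1 - σ i) ≤ M.S
      · exfalso
        obtain ⟨a', ha'⟩ := M.exists_γ_pos i.2
        have hf : M.Feasible j.1 (⟨j.1 - (i.1 - σ i), by omega⟩ : M.Rate) :=
          ⟨by simp only; omega, by simp only; omega⟩
        have hn : M.next i (σ i) a' = M.next j ⟨j.1 - (i.1 - σ i), by omega⟩ a' := by
          refine M.state_ext ?_ rfl
          rw [M.next_fst hf, M.next_fst (hσ i)]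
          simp only
          omega
        refine hdisj' _ (hBσ i hi a' ha') ?_
        rw [hn]
        exact hD' j hj _ hf a' (hij ▸ ha')
      · have hf : M.Feasible j.1 (Fin.last M.S) :=
          ⟨by simp only [Fin.val_last]; omega, by simp only [Fin.val_last]; omega⟩
        have key : ∀ a', 0 < M.γ i.2 a' → (σ i : ℕ) = M.S ∧ M.next i (σ i) a' ∈ T := by
          intro a' ha'
          have m1 := hBσ i hi a' ha'
          have m2 := hD' j hj _ hf a' (hij ▸ ha')
          have e1 := M.next_fst (hσ i) a'
          have e2 := M.next_fst hf a'
          simp only [Fin.val_last] at e2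
          have := hmin (j.1 - M.S - (i.1 - σ i)) _ m1 _ m2 rfl (Or.inl (by omega))
          exact ⟨by omega, m1, _, m2, rfl, by omega⟩
        obtain ⟨a', ha'⟩ := M.exists_γ_pos i.2
        exact ⟨(key a' ha').1, fun a' ha' => (key a' ha').2⟩
    -- On `T` the rate is always `S`, at least the number of arrivals, so the queue never grows.
    -- From its minimum every arrival number must be `A`, which irreducibility forbids.
    obtain ⟨i0, hi0, hi0min⟩ := Set.exists_min_image T (fun i => (i.1 : ℕ)) (Set.toFinite _)
      ⟨i, hi, j, hj, hij, h⟩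
    have hstep : ∀ i ∈ T, (i.1 : ℕ) = i0.1 → ∀ a', 0 < M.γ i.2 a' →
        (a' : ℕ) = M.A ∧ ((M.next i (σ i) a').1 : ℕ) = i0.1 := by
      intro i hi he a' ha'
      obtain ⟨h1, h2⟩ := hT i hi
      have h3 := hi0min _ (h2 a' ha')
      have h4 := M.next_fst (hσ i) a'
      have h5 := (hσ i).1
      have h6 := a'.2
      omega
    obtain ⟨a, a', ha, hne⟩ := M.exists_arrival_ne (Fin.last M.A)
    obtain ⟨k, hk, hk0, rfl⟩ : ∃ k ∈ T, (k.1 : ℕ) = i0.1 ∧ k.2 = a := by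
      refine M.mem_of_arrivals_closed (B := {a | ∃ k ∈ T, (k.1 : ℕ) = i0.1 ∧ k.2 = a})
        ⟨_, i0, hi0, rfl, rfl⟩ ?_ a
      rintro _ ⟨k, hk, hk0, rfl⟩ a' ha
      exact ⟨_, (hT k hk).2 a' ha, (hstep k hk hk0 a' ha).2, rfl⟩
    exact hne (Fin.ext (hstep k hk hk0 a' ha).1)
  · rw [← hd] at h
    -- The mirror case: now `j` is the lower state and transmits nothing, which forces `σ i = 0`;
    -- the queue never shrinks on `T`, and at its maximum all arrivals would be zero.
    let T : Set M.State := {i | i ∈ B ∧ ∃ j ∈ D, i.2 = j.2 ∧ (i.1 : ℕ) = j.1 + d}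
    have hT : ∀ i ∈ T, (σ i : ℕ) = 0 ∧ ∀ a', 0 < M.γ i.2 a' → M.next i (σ i) a' ∈ T := by
      rintro i ⟨hi, j, hj, hij, h⟩
      obtain ⟨hf1, hf2⟩ := hσ i
      have hiQ := i.1.2
      have hsS := (σ i).2
      by_cases hc : (i.1 : ℕ) - σ i ≤ j.1
      · exfalso
        obtain ⟨a', ha'⟩ := M.exists_γ_pos i.2
        have hf : M.Feasible j.1 (⟨j.1 - (i.1 - σ i), by omega⟩ : M.Rate) :=
          ⟨by simp only; omega, by simp only; omega⟩
        have hn : M.next i (σ i) a' = M.next j ⟨j.1 - (i.1 - σ i), by omega⟩ a' := by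
          refine M.state_ext ?_ rfl
          rw [M.next_fst hf, M.next_fst (hσ i)]
          simp only
          omega
        refine hdisj' _ (hBσ i hi a' ha') ?_
        rw [hn]
        exact hD' j hj _ hf a' (hij ▸ ha')
      · have hf : M.Feasible j.1 (0 : M.Rate) :=
          ⟨by simp only [Fin.val_zero]; omega, by simp only [Fin.val_zero]; omega⟩
        have key : ∀ a', 0 < M.γ i.2 a' → (σ i : ℕ) = 0 ∧ M.next i (σ i) a' ∈ T := by
          intro a' ha'
          have m1 := hBσ i hi a' ha'
          have m2 := hD' j hj _ hf a' (hij ▸ ha')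
          have e1 := M.next_fst (hσ i) a'
          have e2 := M.next_fst hf a'
          simp only [Fin.val_zero] at e2
          have := hmin (i.1 - σ i - j.1) _ m1 _ m2 rfl (Or.inr (by omega))
          exact ⟨by omega, m1, _, m2, rfl, by omega⟩
        obtain ⟨a', ha'⟩ := M.exists_γ_pos i.2
        exact ⟨(key a' ha').1, fun a' ha' => (key a' ha').2⟩
    obtain ⟨i0, hi0, hi0max⟩ := Set.exists_max_image T (fun i => (i.1 : ℕ)) (Set.toFinite _)
      ⟨i, hi, j, hj, hij, h⟩
    have hstep : ∀ i ∈ T, (i.1 : ℕ) = i0.1 → ∀ a', 0 < M.γ i.2 a' →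
        (a' : ℕ) = 0 ∧ ((M.next i (σ i) a').1 : ℕ) = i0.1 := by
      intro i hi he a' ha'
      obtain ⟨h1, h2⟩ := hT i hi
      have h3 := hi0max _ (h2 a' ha')
      have h4 := M.next_fst (hσ i) a'
      omega
    obtain ⟨a, a', ha, hne⟩ := M.exists_arrival_ne 0
    obtain ⟨k, hk, hk0, rfl⟩ : ∃ k ∈ T, (k.1 : ℕ) = i0.1 ∧ k.2 = a := by
      refine M.mem_of_arrivals_closed (B := {a | ∃ k ∈ T, (k.1 : ℕ) = i0.1 ∧ k.2 = a})
        ⟨_, i0, hi0, rfl, rfl⟩ ?_ a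
      rintro _ ⟨k, hk, hk0, rfl⟩ a' ha
      exact ⟨_, (hT k hk).2 a' ha, (hstep k hk hk0 a' ha).2, rfl⟩
    exact hne (Fin.ext (hstep k hk hk0 a' ha).1)

/-- `B` can be reached from `i` in `n` steps with suitable rates. -/
def CanReach (M : AWGNLink) (B : Set M.State) : ℕ → M.State → Prop
  | 0, i => i ∈ B
  | n + 1, i => ∃ s, M.Feasible i.1 s ∧ ∃ a', 0 < M.γ i.2 a' ∧ M.CanReach B n (M.next i s a')

theorem Absorbing.exists_canReach (hσ : M.IsSelector σ) {B : Set M.State}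
    (hBσ : M.Absorbing σ B) (hB : B.Nonempty) (i : M.State) : ∃ n, M.CanReach B n i := by
  by_contra! h
  obtain ⟨j, hj, hj'⟩ := Absorbing.meet hσ hBσ hB (D := {i | ∀ n, ¬ M.CanReach B n i}) ⟨i, h⟩
    (fun i hi s hs a' ha n hn => hi (n + 1) ⟨s, hs, a', ha, hn⟩)
  exact hj' 0 hj

/-- Outside an absorbing set the rates can be changed so that it is reached from everywhere. -/
theorem Absorbing.exists_attracting (hσ : M.IsSelector σ) {B : Set M.State}
    (hBσ : M.Absorbing σ B) (hB : B.Nonempty) :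
    ∃ τ, M.IsSelector τ ∧ (∀ i ∈ B, τ i = σ i) ∧
      ∀ C : Set M.State, C.Nonempty → M.Absorbing τ C → (C ∩ B).Nonempty := by
  classical
  have hex := fun i => Absorbing.exists_canReach hσ hBσ hB i
  -- The least number of steps to `B`. Outside `B` the new rate lowers it with positive probability,
  -- so a closed set attains its minimum of `r` inside `B`.
  let r : M.State → ℕ := fun i => Nat.find (hex i)
  have hstep : ∀ i, ∃ s, M.Feasible i.1 s ∧ (i ∈ B → s = σ i) ∧
      (i ∉ B → ∃ a', 0 < M.γ i.2 a' ∧ r (M.next i s a') < r i) := by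
    intro i
    by_cases hi : i ∈ B
    · exact ⟨σ i, hσ i, fun _ => rfl, fun h => (h hi).elim⟩
    · have hspec : M.CanReach B (r i) i := Nat.find_spec (hex i)
      rcases hr : r i with _ | n
      · rw [hr] at hspec
        exact (hi hspec).elim
      · rw [hr] at hspec
        obtain ⟨s, hs, a', ha, hn⟩ := hspec
        exact ⟨s, hs, fun h => (hi h).elim, fun _ =>
          ⟨a', ha, Nat.lt_succ_of_le (Nat.find_min' (hex _) hn)⟩⟩
  choose τ h1 h2 h3 using hstep
  refine ⟨τ, h1, h2, fun C hC hCτ => ?_⟩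
  obtain ⟨i, hi, hmin⟩ := Set.exists_min_image C r (Set.toFinite _) hC
  refine ⟨i, hi, by_contra fun hiB => ?_⟩
  obtain ⟨a', ha, hlt⟩ := h3 i hiB
  exact absurd (hmin _ (hCτ i hi a' ha)) (not_le.2 hlt)

theorem Absorbing.exists_stationary (hσ : M.IsSelector σ) {C : Set M.State}
    (hC : M.Absorbing σ C) (hne : C.Nonempty) :
    ∃ π, (M.detPolicy σ hσ).IsStationary π ∧ ∀ i, i ∉ C → π i = 0 := by
  classical
  have : Nonempty C := hne.to_subtype
  have hC' := (absorbing_iff hσ).2 hC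
  set F := M.detPolicy σ hσ
  have hout : ∀ i ∈ C, ∀ j, j ∉ C → F.trans i j = 0 := fun i hi j hj =>
    le_antisymm (not_lt.1 fun h => hj (hC' i hi j h)) (F.trans_nonneg i j)
  have hsub : ∀ f : M.State → ℝ, (∀ i, i ∉ C → f i = 0) → ∑ i : C, f i = ∑ i, f i := by
    intro f hf
    rw [← Finset.sum_subtype (Finset.univ.filter (· ∈ C)) (by simp) f]
    exact Finset.sum_filter_of_ne fun i _ h => by_contra fun hi => h (hf i hi)
  obtain ⟨v, hv0, hv1, hv⟩ := FiniteChain.exists_stationary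
    (p := fun i j : C => F.trans i j) (fun i j => F.trans_nonneg i j)
    (fun i => (hsub _ (hout i i.2)).trans (F.sum_trans_eq_one i))
  let π : M.State → ℝ := fun i => if h : i ∈ C then v ⟨i, h⟩ else 0
  have hπ : ∀ i : C, π i = v i := fun i => dif_pos i.2
  have hπ0 : ∀ i, i ∉ C → π i = 0 := fun i hi => dif_neg hi
  refine ⟨π, ⟨fun i => ?_, ?_, fun j => ?_⟩, hπ0⟩
  · by_cases hi : i ∈ C
    · exact (hπ ⟨i, hi⟩).symm ▸ hv0 ⟨i, hi⟩
    · exact (hπ0 i hi).ge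
  · rw [← hsub π hπ0, ← hv1]
    exact Finset.sum_congr rfl fun i _ => hπ i
  · rw [← hsub (fun i => π i * F.trans i j) fun i hi => by rw [hπ0 i hi, zero_mul]]
    by_cases hj : j ∈ C
    · rw [hπ ⟨j, hj⟩, ← hv ⟨j, hj⟩]
      exact Finset.sum_congr rfl fun i _ => by rw [hπ]
    · rw [hπ0 j hj]
      exact Finset.sum_eq_zero fun i _ => by rw [hout i i.2 j hj, mul_zero]

/-! ### State-action frequencies -/

/-- The balance equations in weak form, tested against a function of the state; every later use of
stationarity of frequencies goes through it. -/
theorem sum_expect_of_mem_frequencies {x : M.State → M.Rate → ℝ} (hx : x ∈ M.frequencies)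
    (f : M.State → ℝ) :
    ∑ i, ∑ s, x i s * M.expect f i s = ∑ i, ∑ s, x i s * f i := by
  have h1 : ∑ j, (∑ i : M.State, ∑ s : M.Rate, M.γ i.2 j.2 * x i s *
      (if (s : ℕ) + (j.1 : ℕ) = (i.1 : ℕ) + (j.2 : ℕ) then 1 else 0)) * f j
        = ∑ i, ∑ s, x i s * f i := by
    refine Finset.sum_congr rfl fun j _ => ?_
    rw [hx.1 j, Finset.sum_mul]
  rw [← h1]
  simp only [Finset.sum_mul]
  refine Eq.symm (Finset.sum_comm.trans ?_)
  refine Finset.sum_congr rfl fun i _ => Finset.sum_comm.trans ?_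
  refine Finset.sum_congr rfl fun s _ => ?_
  by_cases hs : M.Feasible i.1 s
  · rw [← M.sum_kernel hs, Finset.mul_sum]
    exact Finset.sum_congr rfl fun j _ => by ring
  · simp [hx.2.2.2 i s hs]

theorem convex_frequencies (M : AWGNLink) : Convex ℝ M.frequencies := by
  intro x hx y hy a b ha hb hab
  refine ⟨fun j => ?_, ?_, fun i s => ?_, fun i s hs => ?_⟩
  · have e1 := hx.1 j
    have e2 := hy.1 j
    simp only [Pi.add_apply, Pi.smul_apply, smul_eq_mul, Finset.sum_add_distrib,
      ← Finset.mul_sum, ← e1, ← e2]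
    simp only [Finset.mul_sum, ← Finset.sum_add_distrib]
    exact Finset.sum_congr rfl fun i _ => Finset.sum_congr rfl fun s _ => by ring
  · simp only [Pi.add_apply, Pi.smul_apply, smul_eq_mul, Finset.sum_add_distrib,
      ← Finset.mul_sum, hx.2.1, hy.2.1, mul_one, hab]
  · simp only [Pi.add_apply, Pi.smul_apply, smul_eq_mul]
    exact add_nonneg (mul_nonneg ha (hx.2.2.1 i s)) (mul_nonneg hb (hy.2.2.1 i s))
  · simp [hx.2.2.2 i s hs, hy.2.2.2 i s hs]

theorem power_combo (M : AWGNLink) (a b : ℝ) (x y : M.State → M.Rate → ℝ) :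
    M.power (a • x + b • y) = a * M.power x + b * M.power y := by
  simp only [power, Finset.mul_sum, ← Finset.sum_add_distrib, Pi.add_apply, Pi.smul_apply,
    smul_eq_mul]
  exact Finset.sum_congr rfl fun i _ => Finset.sum_congr rfl fun s _ => by ring

theorem delay_combo (M : AWGNLink) (a b : ℝ) (x y : M.State → M.Rate → ℝ) :
    M.delay (a • x + b • y) = a * M.delay x + b * M.delay y := by
  simp only [delay, Finset.mul_sum, ← Finset.sum_add_distrib, Pi.add_apply, Pi.smul_apply,
    smul_eq_mul]
  exact Finset.sum_congr rfl fun i _ => Finset.sum_congr rfl fun s _ => by ring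

theorem convex_obtainable (M : AWGNLink) : Convex ℝ M.obtainable := by
  rintro _ ⟨x, hx, rfl⟩ _ ⟨y, hy, rfl⟩ a b ha hb hab
  refine ⟨a • x + b • y, M.convex_frequencies hx hy ha hb hab, ?_⟩
  rw [power_combo, delay_combo]
  rfl

theorem Policy.IsStationary.mem_frequencies {F : M.Policy} {π : M.State → ℝ}
    (h : F.IsStationary π) : (fun i s => π i * F.f i s) ∈ M.frequencies := by
  refine ⟨fun j => ?_, ?_, fun i s => mul_nonneg (h.1 i) (F.nonneg i s), fun i s hs => ?_⟩
  · rw [← Finset.mul_sum, F.sum_one, mul_one, ← h.2.2 j]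
    refine Finset.sum_congr rfl fun i _ => ?_
    rw [Policy.trans, Finset.mul_sum, Finset.mul_sum]
    refine Finset.sum_congr rfl fun s _ => ?_
    split_ifs <;> ring
  · simp only [← Finset.mul_sum, F.sum_one, mul_one, h.2.1]
  · simp only [F.feasible i s hs, mul_zero]

/-- The (power, delay) pair of a distribution of states under a policy. -/
noncomputable def Policy.pair (F : M.Policy) (π : M.State → ℝ) : ℝ × ℝ :=
  (M.power fun i s => π i * F.f i s, M.delay fun i s => π i * F.f i s)

theorem Policy.pair_snd (F : M.Policy) (π : M.State → ℝ) :
    (F.pair π).2 = 1 / M.α * ∑ i : M.State, (i.1 : ℝ) * π i := by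
  simp only [pair, delay, ← mul_assoc, ← Finset.mul_sum, F.sum_one, mul_one]

theorem Policy.obtains_iff (F : M.Policy) {z : ℝ × ℝ} :
    F.Obtains z ↔ ∃ π, F.IsStationary π ∧ z = F.pair π := by
  refine exists_congr fun π => and_congr_right fun _ => ?_
  rw [Prod.ext_iff, F.pair_snd]
  rfl

theorem Policy.Obtains.mem_obtainable {F : M.Policy} {z : ℝ × ℝ} (h : F.Obtains z) :
    z ∈ M.obtainable := by
  obtain ⟨π, hπ, rfl⟩ := F.obtains_iff.1 h
  exact ⟨_, hπ.mem_frequencies, rfl⟩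

/-! ### Vertices -/

/-- If some `y` is strictly better than `z` in both coordinates, mixing `y` instead of `z` with `w`
is strictly better than the given mixture. -/
theorem isExtreme_curve (M : AWGNLink) : IsExtreme ℝ M.obtainable M.curve := by
  refine ⟨fun z hz => hz.1, ?_⟩
  rintro z hz w hw v hv ⟨a, b, ha, hb, hab, rfl⟩
  refine ⟨hz, fun y hy => ?_⟩
  by_contra! h
  rcases hv.2 _ (M.convex_obtainable hy hw ha.le hb.le hab) with h1 | h1
  · simp only [Prod.fst_add, Prod.smul_fst, smul_eq_mul] at h1
    nlinarith
  · simp only [Prod.snd_add, Prod.smul_snd, smul_eq_mul] at h1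
    nlinarith

theorem vertices_subset (M : AWGNLink) : M.vertices ⊆ M.obtainable.extremePoints ℝ :=
  M.isExtreme_curve.extremePoints_subset_extremePoints

/-- Frequencies whose support is within that of frequencies over an extreme point lie over the
same point. -/
theorem eq_of_support_subset {z : ℝ × ℝ} (hz : z ∈ M.obtainable.extremePoints ℝ)
    {x y : M.State → M.Rate → ℝ} (hx : x ∈ M.frequencies) (hy : y ∈ M.frequencies)
    (hzx : z = (M.power x, M.delay x)) (hsupp : ∀ i s, 0 < y i s → 0 < x i s) :
    (M.power y, M.delay y) = z := by
  -- A small multiple of `y` fits under `x`, so `x` is a proper mixture of `y` and the normalized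
  -- remainder; extremality then puts `y` over the same point.
  obtain ⟨t, ht0, ht1, ht⟩ : ∃ t : ℝ, 0 < t ∧ t < 1 ∧ ∀ i s, t * y i s ≤ x i s := by
    have h1 : ∀ p : M.State × M.Rate, ∃ t : ℝ, 0 < t ∧ t * y p.1 p.2 ≤ x p.1 p.2 := by
      intro p
      rcases (hy.2.2.1 p.1 p.2).eq_or_lt with h | h
      · exact ⟨1, one_pos, by rw [← h, mul_zero]; exact hx.2.2.1 _ _⟩
      · exact ⟨x p.1 p.2 / y p.1 p.2, div_pos (hsupp _ _ h) h,
          by rw [div_mul_cancel₀ _ h.ne']⟩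
    choose u hu0 hu using h1
    obtain ⟨p, -, hp⟩ := Finset.exists_min_image Finset.univ u ⟨(M.st 0 0, 0), Finset.mem_univ _⟩
    refine ⟨min (u p) (1 / 2), lt_min (hu0 p) (by norm_num),
      (min_le_right _ _).trans_lt (by norm_num), fun i s => ?_⟩
    refine le_trans (mul_le_mul_of_nonneg_right ?_ (hy.2.2.1 i s)) (hu (i, s))
    exact (min_le_left _ _).trans (hp _ (Finset.mem_univ _))
  have ht1' : 0 < 1 - t := by linarith
  let x' : M.State → M.Rate → ℝ := (1 - t)⁻¹ • (x - t • y)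
  have hxx : x = t • y + (1 - t) • x' := by
    ext i s
    simp only [x', Pi.add_apply, Pi.smul_apply, Pi.sub_apply, smul_eq_mul]
    field_simp
    ring
  have hx' : x' ∈ M.frequencies := by
    refine ⟨fun j => ?_, ?_, fun i s => ?_, fun i s hs => ?_⟩
    · have e1 := hx.1 j
      have e2 := hy.1 j
      simp only [x', Pi.sub_apply, Pi.smul_apply, smul_eq_mul, Finset.sum_sub_distrib,
        ← Finset.mul_sum, ← e1, ← e2]
      simp only [Finset.mul_sum, ← Finset.sum_sub_distrib]
      exact Finset.sum_congr rfl fun i _ => Finset.sum_congr rfl fun s _ => by ring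
    · simp only [x', Pi.sub_apply, Pi.smul_apply, smul_eq_mul, Finset.sum_sub_distrib,
        ← Finset.mul_sum, hx.2.1, hy.2.1, mul_one]
      exact inv_mul_cancel₀ ht1'.ne'
    · exact mul_nonneg (inv_nonneg.2 ht1'.le) (sub_nonneg.2 (ht i s))
    · simp [x', hx.2.2.2 i s hs, hy.2.2.2 i s hs]
  refine hz.2 ⟨y, hy, rfl⟩ ⟨x', hx', rfl⟩ ⟨t, 1 - t, ht0, ht1', by ring, ?_⟩
  rw [hzx]
  conv_rhs => rw [hxx]
  rw [power_combo, delay_combo]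
  rfl

theorem exists_selector_of_extreme {z : ℝ × ℝ} (hz : z ∈ M.obtainable.extremePoints ℝ) :
    ∃ σ, ∃ hσ : M.IsSelector σ, (M.detPolicy σ hσ).IsUnichain ∧ (M.detPolicy σ hσ).Obtains z := by
  classical
  obtain ⟨x, hx, hzx⟩ := hz.1
  obtain ⟨σ₀, hσ₀⟩ := M.exists_isSelector
  have hsel : ∀ i, ∃ s, M.Feasible i.1 s ∧ ((∃ s', 0 < x i s') → 0 < x i s) := by
    intro i
    by_cases h : ∃ s, 0 < x i s
    · obtain ⟨s, hs⟩ := h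
      exact ⟨s, by_contra fun hf => hs.ne' (hx.2.2.2 i s hf), fun _ => hs⟩
    · exact ⟨σ₀ i, hσ₀ i, fun h' => (h h').elim⟩
  choose σ hσ hσx using hsel
  let C : Set M.State := {i | ∃ s, 0 < x i s}
  have hCne : C.Nonempty := by
    by_contra h
    have h0 : ∀ i s, x i s = 0 := fun i s =>
      le_antisymm (not_lt.1 fun hp => h ⟨i, s, hp⟩) (hx.2.2.1 i s)
    have := hx.2.1
    simp [h0] at this
  -- Testing balance against the indicator of a next state outside `C` gives zero mass on one side
  -- and a positive inflow on the other.
  have hCσ : M.Absorbing σ C := by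
    intro i hi a' ha
    by_contra hn
    have h0 : ∀ s, x (M.next i (σ i) a') s = 0 := fun s =>
      le_antisymm (not_lt.1 fun hp => hn ⟨s, hp⟩) (hx.2.2.1 _ s)
    have h1 := sum_expect_of_mem_frequencies hx
      (fun j => if j = M.next i (σ i) a' then (1 : ℝ) else 0)
    have h2 : ∑ j, ∑ s, x j s * (if j = M.next i (σ i) a' then (1 : ℝ) else 0) = 0 := by
      refine Finset.sum_eq_zero fun j _ => Finset.sum_eq_zero fun s _ => ?_
      split_ifs with hj
      · rw [hj, h0, zero_mul]
      · rw [mul_zero]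
    rw [h2] at h1
    have hE : ∀ j s, 0 ≤ M.expect (fun j => if j = M.next i (σ i) a' then (1 : ℝ) else 0) j s :=
      fun j s => Finset.sum_nonneg fun b _ => mul_nonneg (M.γ_nonneg _ _) (by dsimp only; split_ifs <;> simp)
    have h3 : 0 < ∑ j, ∑ s, x j s *
        M.expect (fun j => if j = M.next i (σ i) a' then (1 : ℝ) else 0) j s := by
      refine Finset.sum_pos' (fun j _ => Finset.sum_nonneg fun s _ =>
        mul_nonneg (hx.2.2.1 j s) (hE j s)) ⟨i, Finset.mem_univ i, ?_⟩
      refine Finset.sum_pos' (fun s _ => mul_nonneg (hx.2.2.1 i s) (hE i s))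
        ⟨σ i, Finset.mem_univ _, mul_pos (hσx i hi) ?_⟩
      refine Finset.sum_pos' (fun b _ => mul_nonneg (M.γ_nonneg _ _) (by dsimp only; split_ifs <;> simp))
        ⟨a', Finset.mem_univ _, ?_⟩
      simpa using ha
    exact h3.ne' h1
  obtain ⟨B, hBC, hBne, hB, hBcomm⟩ := FiniteChain.exists_communicating
    (fun i j => 0 < (M.detPolicy σ hσ).trans i j) hCne ((absorbing_iff hσ).2 hCσ)
  rw [absorbing_iff hσ] at hB
  obtain ⟨τ, hτ, hτB, hatt⟩ := Absorbing.exists_attracting hσ hB hBne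
  have hBτ : M.Absorbing τ B := fun i hi a' ha => hτB i hi ▸ hB i hi a' ha
  have hsub : ∀ D : Set M.State, D.Nonempty → M.Absorbing τ D → B ⊆ D := by
    intro D hD hDτ j hj
    obtain ⟨i, hiD, hiB⟩ := hatt D hD hDτ
    have hr := hBcomm i hiB j hj
    clear hj
    suffices j ∈ D ∩ B from this.1
    induction hr with
    | refl => exact ⟨hiD, hiB⟩
    | tail _ h2 ih =>
      obtain ⟨g1, g2⟩ := (detPolicy_trans_pos hσ).1 h2
      rw [g2]
      exact ⟨hτB _ ih.2 ▸ hDτ _ ih.1 _ g1, hB _ ih.2 _ g1⟩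
  refine ⟨τ, hτ, ?_, ?_⟩
  · refine Policy.isUnichain_of_meet _ fun D D' hD hD' h h' => ?_
    obtain ⟨i, hi⟩ := hBne
    exact ⟨i, hsub D hD ((absorbing_iff hτ).1 h) hi, hsub D' hD' ((absorbing_iff hτ).1 h') hi⟩
  · obtain ⟨π, hπ, hπ0⟩ := Absorbing.exists_stationary hτ hBτ hBne
    refine (Policy.obtains_iff _).2 ⟨π, hπ, ?_⟩
    refine (eq_of_support_subset hz hx hπ.mem_frequencies hzx fun i s hs => ?_).symm
    have hs' : s = τ i := by
      by_contra hne
      simp [detPolicy, hne] at hs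
    have hiB : i ∈ B := by
      by_contra hne
      simp [hπ0 i hne] at hs
    rw [hs', hτB i hiB]
    exact hσx i (hBC hiB)

end AWGNLink

/-! ### Convex sequences -/

/-- Convexity of a sequence on `{0, …, N}`. -/
def ConvexUpTo (N : ℕ) (f : ℕ → ℝ) : Prop := ∀ n, n + 2 ≤ N → 2 * f (n + 1) ≤ f n + f (n + 2)

theorem ConvexUpTo.slope_mono {N : ℕ} {f : ℕ → ℝ} (hf : ConvexUpTo N f) {n m : ℕ} (hnm : n ≤ m)
    (hm : m + 1 ≤ N) : f (n + 1) - f n ≤ f (m + 1) - f m := by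
  induction m, hnm using Nat.le_induction with
  | base => exact le_rfl
  | succ m _ ih => linarith [ih (by omega), hf m (by omega)]

theorem ConvexUpTo.increment_mono {N : ℕ} {f : ℕ → ℝ} (hf : ConvexUpTo N f) {n m : ℕ}
    (hnm : n ≤ m) (k : ℕ) (hm : m + k ≤ N) : f (n + k) - f n ≤ f (m + k) - f m := by
  induction k with
  | zero => simp
  | succ k ih =>
    have := hf.slope_mono (n := n + k) (m := m + k) (by omega) (by omega)
    have := ih (by omega)
    simp only [← add_assoc]
    linarith

/-- Moving two points towards each other with their sum fixed does not increase the sum of a convex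
function. -/
theorem ConvexUpTo.four_point {N : ℕ} {f : ℕ → ℝ} (hf : ConvexUpTo N f) {x y a b : ℕ}
    (hx : x ≤ N) (hy : y ≤ N) (hab : a + b = x + y) (ha : x ≤ a ∧ a ≤ y ∨ y ≤ a ∧ a ≤ x) :
    f a + f b ≤ f x + f y := by
  rcases ha with ⟨h1, h2⟩ | ⟨h1, h2⟩
  · have := hf.increment_mono (n := x) (m := b) (by omega) (a - x) (by omega)
    rw [show x + (a - x) = a by omega, show b + (a - x) = y by omega] at this
    linarith
  · have := hf.increment_mono (n := y) (m := b) (by omega) (a - y) (by omega)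
    rw [show y + (a - y) = a by omega, show b + (a - y) = x by omega] at this
    linarith

namespace AWGNLink

variable {M : AWGNLink}

/-! ### Dynamic programming -/

/-- The weighted cost of transmitting `s` packets in state `i` plus the discounted expectation
of `f` in the next state. -/
noncomputable def actionValue (M : AWGNLink) (d μ β : ℝ) (f : M.State → ℝ) (i : M.State)
    (s : M.Rate) : ℝ :=
  d * M.P s + μ * (i.1 : ℝ) + β * M.expect f i s

/-- The optimality equation with discount `β` and gain `g`. -/
def IsBellman (M : AWGNLink) (d μ β g : ℝ) (h : M.State → ℝ) : Prop :=
  ∀ i : M.State, (∀ s, M.Feasible i.1 s → h i + g ≤ M.actionValue d μ β h i s) ∧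
    ∃ s, M.Feasible i.1 s ∧ h i + g = M.actionValue d μ β h i s

/-- Convexity in the queue length. -/
def QConvex (M : AWGNLink) (f : M.State → ℝ) : Prop :=
  ∀ a, ConvexUpTo M.Q fun q => f (M.st q a)

theorem st_eta (M : AWGNLink) (i : M.State) : M.st i.1 i.2 = i :=
  M.state_ext (M.st_fst (by omega) _) rfl

/-- `ht` puts the new rates between the old rates, and `hu` the new remaining queues between the old
ones, with sums preserved. The four-point inequality then applies to `P` and, arrival by arrival, to
`f`. This one inequality yields propagation of convexity and monotonicity of optimal rates. -/
theorem exchange {d μ β : ℝ} (hd : 0 ≤ d) (hβ : 0 ≤ β) {f : M.State → ℝ} (hf : M.QConvex f)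
    {i₁ i₂ j₁ j₂ : M.State} {s₁ s₂ t₁ t₂ : M.Rate} (h₁ : M.Feasible i₁.1 s₁)
    (h₂ : M.Feasible i₂.1 s₂) (hi : i₂.2 = i₁.2) (hj₁ : j₁.2 = i₁.2) (hj₂ : j₂.2 = i₁.2)
    (hij : (j₁.1 : ℕ) + j₂.1 = i₁.1 + i₂.1) (hst : (t₁ : ℕ) + t₂ = s₁ + s₂)
    (ht : (s₁ : ℕ) ≤ t₁ ∧ (t₁ : ℕ) ≤ s₂ ∨ (s₂ : ℕ) ≤ t₁ ∧ (t₁ : ℕ) ≤ s₁)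
    (hu : (i₁.1 : ℕ) + t₁ ≤ j₁.1 + s₁ ∧ (j₁.1 : ℕ) + s₂ ≤ i₂.1 + t₁ ∨
      (i₂.1 : ℕ) + t₁ ≤ j₁.1 + s₂ ∧ (j₁.1 : ℕ) + s₁ ≤ i₁.1 + t₁) :
    M.Feasible j₁.1 t₁ ∧ M.Feasible j₂.1 t₂ ∧
      M.actionValue d μ β f j₁ t₁ + M.actionValue d μ β f j₂ t₂ ≤
        M.actionValue d μ β f i₁ s₁ + M.actionValue d μ β f i₂ s₂ := by
  obtain ⟨a1, a2⟩ := h₁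
  obtain ⟨b1, b2⟩ := h₂
  have hA := M.A_le_Q
  refine ⟨⟨by omega, by omega⟩, ⟨by omega, by omega⟩, ?_⟩
  have hP : M.P t₁ + M.P t₂ ≤ M.P s₁ + M.P s₂ :=
    ConvexUpTo.four_point (N := M.S) M.P_convex (by omega) (by omega) hst ht
  have hq : (j₁.1 : ℝ) + (j₂.1 : ℝ) = (i₁.1 : ℝ) + (i₂.1 : ℝ) := by exact_mod_cast hij
  have hE : M.expect f j₁ t₁ + M.expect f j₂ t₂ ≤ M.expect f i₁ s₁ + M.expect f i₂ s₂ := by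
    simp only [expect, next, hi, hj₁, hj₂, ← Finset.sum_add_distrib, ← mul_add]
    refine Finset.sum_le_sum fun a _ => mul_le_mul_of_nonneg_left ?_ (M.γ_nonneg _ _)
    have := a.2
    exact (hf a).four_point (by omega) (by omega) (by omega) (by omega)
  simp only [actionValue]
  nlinarith [mul_le_mul_of_nonneg_left hP hd, mul_le_mul_of_nonneg_left hE hβ, congrArg (μ * ·) hq]

open Classical in
/-- The feasible rates in state `i`. -/
noncomputable def rates (M : AWGNLink) (i : M.State) : Finset M.Rate :=
  Finset.univ.filter fun s => M.Feasible i.1 s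

theorem mem_rates {i : M.State} {s : M.Rate} : s ∈ M.rates i ↔ M.Feasible i.1 s := by
  simp [rates]

theorem rates_nonempty (M : AWGNLink) (i : M.State) : (M.rates i).Nonempty := by
  obtain ⟨σ, hσ⟩ := M.exists_isSelector
  exact ⟨σ i, mem_rates.2 (hσ i)⟩

/-- The dynamic programming operator. -/
noncomputable def bellman (M : AWGNLink) (d μ β : ℝ) (f : M.State → ℝ) (i : M.State) : ℝ :=
  (M.rates i).inf' (M.rates_nonempty i) (M.actionValue d μ β f i)

theorem bellman_le (d μ β : ℝ) (f : M.State → ℝ) {i : M.State} {s : M.Rate}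
    (hs : M.Feasible i.1 s) : M.bellman d μ β f i ≤ M.actionValue d μ β f i s :=
  Finset.inf'_le _ (mem_rates.2 hs)

theorem exists_eq_bellman (d μ β : ℝ) (f : M.State → ℝ) (i : M.State) :
    ∃ s, M.Feasible i.1 s ∧ M.bellman d μ β f i = M.actionValue d μ β f i s := by
  obtain ⟨s, hs, h⟩ := Finset.exists_mem_eq_inf' (M.rates_nonempty i) (M.actionValue d μ β f i)
  exact ⟨s, mem_rates.1 hs, h⟩

theorem QConvex.bellman {d μ β : ℝ} (hd : 0 ≤ d) (hβ : 0 ≤ β) {f : M.State → ℝ}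
    (hf : M.QConvex f) : M.QConvex (M.bellman d μ β f) := by
  intro a q hq
  obtain ⟨s₁, hs₁, e₁⟩ := exists_eq_bellman d μ β f (M.st q a)
  obtain ⟨s₂, hs₂, e₂⟩ := exists_eq_bellman d μ β f (M.st (q + 2) a)
  have f1 := M.st_fst (show q ≤ M.Q by omega) a
  have f2 := M.st_fst (show q + 1 ≤ M.Q by omega) a
  have f3 := M.st_fst hq a
  have := s₁.2
  have := s₂.2
  have := hs₁.1
  have := hs₂.1
  -- Both new states are the midpoint; the total rate is split into its halves rounded down and up,
  -- which keeps rates and remainders in between.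
  obtain ⟨k1, k2, k3⟩ := exchange (μ := μ) hd hβ hf hs₁ hs₂ (j₁ := M.st (q + 1) a)
    (j₂ := M.st (q + 1) a)
    (t₁ := ⟨(s₁ + s₂) / 2, by omega⟩) (t₂ := ⟨s₁ + s₂ - (s₁ + s₂) / 2, by omega⟩) rfl rfl rfl
    (by omega) (by simp only; omega) (by simp only; omega) (by simp only; omega)
  have l1 := bellman_le d μ β f k1
  have l2 := bellman_le d μ β f k2
  simp only
  linarith

/-! ### Discounted costs -/

theorem continuous_expect (i : M.State) (s : M.Rate) :
    Continuous fun f : M.State → ℝ => M.expect f i s := by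
  unfold expect
  fun_prop

theorem isClosed_qConvex (M : AWGNLink) : IsClosed {f | M.QConvex f} := by
  have : {f | M.QConvex f} = ⋂ a, ⋂ q, ⋂ _ : q + 2 ≤ M.Q,
      {f : M.State → ℝ | 2 * f (M.st (q + 1) a) ≤ f (M.st q a) + f (M.st (q + 2) a)} := by
    ext f
    simp [QConvex, ConvexUpTo]
  rw [this]
  refine isClosed_iInter fun a => isClosed_iInter fun q => isClosed_iInter fun _ => ?_
  exact isClosed_le (by fun_prop) (by fun_prop)

theorem bellman_le_add_dist {d μ β : ℝ} (hβ : 0 ≤ β) (f g : M.State → ℝ) (i : M.State) :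
    M.bellman d μ β f i ≤ M.bellman d μ β g i + β * dist f g := by
  obtain ⟨s, hs, e⟩ := exists_eq_bellman d μ β g i
  refine (bellman_le d μ β f hs).trans ?_
  rw [e]
  have h1 : M.expect f i s ≤ M.expect (fun j => 1 * g j + dist f g) i s := by
    refine M.expect_mono (fun j => ?_) i s
    have := dist_le_pi_dist f g j
    rw [Real.dist_eq] at this
    linarith [le_abs_self (f j - g j)]
  rw [expect_affine] at h1
  simp only [actionValue]
  nlinarith

/-- The dynamic programming operator is a `β`-contraction; its fixed point is the limit of iterates
from zero, and convexity passes to them and to the limit. -/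
theorem exists_discounted {d μ β : ℝ} (hd : 0 ≤ d) (hβ : 0 ≤ β) (hβ1 : β < 1) :
    ∃ v, M.IsBellman d μ β 0 v ∧ M.QConvex v := by
  have hc : ContractingWith β.toNNReal (M.bellman d μ β) := by
    refine ⟨by simpa using hβ1, LipschitzWith.of_dist_le_mul fun f g => ?_⟩
    rw [dist_pi_le_iff (by positivity)]
    intro i
    rw [Real.dist_eq, abs_sub_le_iff]
    have h1 := bellman_le_add_dist (d := d) (μ := μ) hβ f g i
    have h2 := bellman_le_add_dist (d := d) (μ := μ) hβ g f i
    rw [dist_comm] at h2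
    rw [Real.coe_toNNReal β hβ]
    constructor <;> linarith
  refine ⟨_, ?_, M.isClosed_qConvex.mem_of_tendsto (hc.tendsto_iterate_fixedPoint 0)
    (Filter.Eventually.of_forall fun n => ?_)⟩
  · intro i
    have h := congrFun hc.fixedPoint_isFixedPt.eq i
    rw [add_zero]
    constructor
    · intro s hs
      conv_lhs => rw [← h]
      exact bellman_le _ _ _ _ hs
    · obtain ⟨s, hs, e⟩ := exists_eq_bellman d μ β (ContractingWith.fixedPoint _ hc) i
      exact ⟨s, hs, h.symm.trans e⟩
  · induction n with
    | zero => intro a q _; simp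
    | succ n ih =>
      rw [Function.iterate_succ_apply']
      exact QConvex.bellman hd hβ ih

/-! ### Vanishing discount -/

theorem IsBellman.rescale {d μ β : ℝ} {v : M.State → ℝ} (h : M.IsBellman d μ β 0 v) (m : ℝ)
    {ρ : ℝ} (hρ : 0 < ρ) :
    M.IsBellman (ρ * d) (ρ * μ) β (ρ * ((1 - β) * m)) fun i => ρ * v i + -(ρ * m) := by
  have key : ∀ i s, M.actionValue (ρ * d) (ρ * μ) β (fun i => ρ * v i + -(ρ * m)) i s =
      ρ * M.actionValue d μ β v i s - β * (ρ * m) := by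
    intro i s
    simp only [actionValue, expect_affine]
    ring
  intro i
  simp only [key]
  obtain ⟨h1, s, hs, h2⟩ := h i
  refine ⟨fun s hs => ?_, s, hs, ?_⟩
  · have := mul_le_mul_of_nonneg_left (h1 s hs) hρ.le
    linarith
  · rw [← h2]
    ring

/-- The tuple consists of the discount, the scale of the costs, the unscaled gain and the relative
values; closedness lets all four pass to the limit together. -/
theorem isClosed_isBellman (M : AWGNLink) (d μ : ℝ) :
    IsClosed {p : ℝ × ℝ × ℝ × (M.State → ℝ) |
      M.IsBellman (p.2.1 * d) (p.2.1 * μ) p.1 (p.2.1 * p.2.2.1) p.2.2.2} := by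
  have hcont : ∀ (i : M.State) (s : M.Rate), Continuous fun p : ℝ × ℝ × ℝ × (M.State → ℝ) =>
      M.actionValue (p.2.1 * d) (p.2.1 * μ) p.1 p.2.2.2 i s := by
    intro i s
    have := (continuous_expect i s).comp
      (continuous_snd.comp (continuous_snd.comp continuous_snd) :
        Continuous fun p : ℝ × ℝ × ℝ × (M.State → ℝ) => p.2.2.2)
    simp only [Function.comp_def] at this
    unfold actionValue
    fun_prop
  have : {p : ℝ × ℝ × ℝ × (M.State → ℝ) |
      M.IsBellman (p.2.1 * d) (p.2.1 * μ) p.1 (p.2.1 * p.2.2.1) p.2.2.2} =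
      ⋂ i : M.State, (⋂ s ∈ M.rates i, {p : ℝ × ℝ × ℝ × (M.State → ℝ) |
        p.2.2.2 i + p.2.1 * p.2.2.1 ≤
          M.actionValue (p.2.1 * d) (p.2.1 * μ) p.1 p.2.2.2 i s}) ∩
        ⋃ s ∈ M.rates i, {p : ℝ × ℝ × ℝ × (M.State → ℝ) |
          p.2.2.2 i + p.2.1 * p.2.2.1 =
            M.actionValue (p.2.1 * d) (p.2.1 * μ) p.1 p.2.2.2 i s} := by
    ext p
    simp [IsBellman, mem_rates]
  rw [this]
  refine isClosed_iInter fun i => IsClosed.inter ?_ ?_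
  · exact isClosed_biInter fun s _ => isClosed_le (by fun_prop) (hcont i s)
  · exact isClosed_biUnion_finset fun s _ => isClosed_eq (by fun_prop) (hcont i s)

theorem exists_abs_cost_le (M : AWGNLink) (d μ : ℝ) :
    ∃ K, ∀ (i : M.State) (s : M.Rate), |d * M.P s + μ * (i.1 : ℝ)| ≤ K := by
  obtain ⟨K, hK⟩ := (Set.finite_range fun p : M.State × M.Rate =>
    |d * M.P p.2 + μ * (p.1.1 : ℝ)|).bddAbove
  exact ⟨K, fun i s => hK ⟨(i, s), rfl⟩⟩

theorem expect_le {f : M.State → ℝ} {c : ℝ} (h : ∀ i, f i ≤ c) (i : M.State) (s : M.Rate) :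
    M.expect f i s ≤ c := by
  rw [← M.expect_const c i s]
  exact M.expect_mono h i s

theorem le_expect {f : M.State → ℝ} {c : ℝ} (h : ∀ i, c ≤ f i) (i : M.State) (s : M.Rate) :
    c ≤ M.expect f i s := by
  rw [← M.expect_const c i s]
  exact M.expect_mono h i s

theorem eq_of_expect_le {f : M.State → ℝ} {c : ℝ} (h : ∀ i, c ≤ f i) {i : M.State} {s : M.Rate}
    (hc : M.expect f i s ≤ c) {a' : Fin (M.A + 1)} (ha : 0 < M.γ i.2 a') :
    f (M.next i s a') = c := by
  by_contra hne
  have hlt : c < f (M.next i s a') := lt_of_le_of_ne (h _) (Ne.symm hne)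
  have : M.expect (fun _ => c) i s < M.expect f i s :=
    Finset.sum_lt_sum (fun b _ => mul_le_mul_of_nonneg_left (h _) (M.γ_nonneg _ _))
      ⟨a', Finset.mem_univ _, mul_lt_mul_of_pos_left hlt ha⟩
  rw [expect_const] at this
  linarith

theorem eq_of_le_expect {f : M.State → ℝ} {c : ℝ} (h : ∀ i, f i ≤ c) {i : M.State} {s : M.Rate}
    (hc : c ≤ M.expect f i s) {a' : Fin (M.A + 1)} (ha : 0 < M.γ i.2 a') :
    f (M.next i s a') = c := by
  by_contra hne
  have hlt : f (M.next i s a') < c := lt_of_le_of_ne (h _) hne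
  have : M.expect f i s < M.expect (fun _ => c) i s :=
    Finset.sum_lt_sum (fun b _ => mul_le_mul_of_nonneg_left (h _) (M.γ_nonneg _ _))
      ⟨a', Finset.mem_univ _, mul_lt_mul_of_pos_left hlt ha⟩
  rw [expect_const] at this
  linarith

/-- Without running costs, only constants are relative values with range `[0, 1]`. -/
theorem IsBellman.not_zero_one {h : M.State → ℝ} (hB : M.IsBellman 0 0 1 0 h)
    (h0 : ∀ i, 0 ≤ h i) (h1 : ∀ i, h i ≤ 1) {i j : M.State} (hi : h i = 0) (hj : h j = 1) :
    False := by
  have hval : ∀ i s, M.actionValue 0 0 1 h i s = M.expect h i s := by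
    intro i s
    simp [actionValue]
  simp only [IsBellman, hval, add_zero] at hB
  choose hB1 σ hσ hσ' using hB
  -- Where `h` is minimal, an optimal rate leads only to minimal states; where it is maximal, every
  -- feasible rate leads only to maximal states.
  obtain ⟨k, hk, hk'⟩ := Absorbing.meet (B := {i | h i = 0}) (D := {i | h i = 1}) hσ
    (fun i hi a' ha => eq_of_expect_le h0 ((hσ' i).ge.trans hi.le) ha) ⟨i, hi⟩ ⟨j, hj⟩
    (fun i hi s hs a' ha => eq_of_le_expect h1 (hi.ge.trans (hB1 i s hs)) ha)
  rw [mem_ofPred_eq] at hk hk'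
  linarith

/-- No bound on the range of the discounted values is needed: scaling by `ρ = 1 / (1 + range)` keeps
all data in a compact set, with minimum `0` and the value `1 - ρ` attained. -/
theorem exists_normalized {d μ β : ℝ} (hd : 0 ≤ d) (hβ : 0 ≤ β) (hβ1 : β < 1) {K : ℝ}
    (hK : ∀ (i : M.State) (s : M.Rate), |d * M.P s + μ * (i.1 : ℝ)| ≤ K) :
    ∃ ρ κ : ℝ, ∃ ω : M.State → ℝ, ρ ∈ Icc 0 1 ∧ κ ∈ Icc (-K) K ∧ ω ∈ Icc 0 1 ∧
      M.IsBellman (ρ * d) (ρ * μ) β (ρ * κ) ω ∧ M.QConvex ω ∧ (∃ i, ω i = 0) ∧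
      ∃ i, ω i + ρ = 1 := by
  obtain ⟨v, hv, hvc⟩ := M.exists_discounted (μ := μ) hd hβ hβ1
  obtain ⟨i₀, -, hi₀⟩ := Finset.exists_min_image Finset.univ v ⟨M.st 0 0, Finset.mem_univ _⟩
  obtain ⟨i₁, -, hi₁⟩ := Finset.exists_max_image Finset.univ v ⟨M.st 0 0, Finset.mem_univ _⟩
  replace hi₀ := fun i => hi₀ i (Finset.mem_univ i)
  replace hi₁ := fun i => hi₁ i (Finset.mem_univ i)
  have h01 := hi₀ i₁
  set ρ : ℝ := (1 + (v i₁ - v i₀))⁻¹ with hρdef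
  have hden : 0 < 1 + (v i₁ - v i₀) := by linarith
  have hρ : 0 < ρ := inv_pos.2 hden
  have hρ1 : ρ * (1 + (v i₁ - v i₀)) = 1 := inv_mul_cancel₀ hden.ne'
  refine ⟨ρ, (1 - β) * v i₀, fun i => ρ * v i + -(ρ * v i₀), ⟨hρ.le, ?_⟩, ⟨?_, ?_⟩,
    ⟨fun i => ?_, fun i => ?_⟩, hv.rescale _ hρ, ?_, ⟨i₀, by ring⟩, ⟨i₁, by linarith⟩⟩
  · nlinarith
  · obtain ⟨-, s, -, e⟩ := hv i₀
    have := (abs_le.1 (hK i₀ s)).1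
    have := mul_le_mul_of_nonneg_left (le_expect hi₀ i₀ s) hβ
    simp only [actionValue, add_zero] at e
    linarith
  · obtain ⟨s, hs⟩ := M.rates_nonempty i₁
    have e := (hv i₁).1 s (mem_rates.1 hs)
    have := (abs_le.1 (hK i₁ s)).2
    have := mul_le_mul_of_nonneg_left (expect_le hi₁ i₁ s) hβ
    simp only [actionValue, add_zero] at e
    nlinarith
  · have := hi₀ i
    simp only [Pi.zero_apply]
    nlinarith
  · have := hi₁ i
    simp only [Pi.one_apply]
    nlinarith
  · intro a q hq
    have := mul_le_mul_of_nonneg_left (hvc a q hq) hρ.le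
    simp only at this ⊢
    linarith

/-- The average-cost optimality equation has a solution that is convex in the queue length. -/
theorem exists_isBellman {d μ : ℝ} (hd : 0 ≤ d) :
    ∃ (g : ℝ) (h : M.State → ℝ), M.IsBellman d μ 1 g h ∧ M.QConvex h := by
  obtain ⟨K, hK⟩ := M.exists_abs_cost_le d μ
  have hb0 : ∀ n : ℕ, (0 : ℝ) < 1 / (n + 1) := fun n => by positivity
  have hb1 : ∀ n : ℕ, (1 : ℝ) / (n + 1) ≤ 1 := fun n => by
    rw [div_le_one (by positivity)]
    linarith [Nat.cast_nonneg (α := ℝ) n]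
  choose ρ κ ω hρ hκ hω hB hc h0 h1 using fun n : ℕ =>
    M.exists_normalized (μ := μ) hd (β := 1 - 1 / (n + 1)) (by linarith [hb1 n])
      (by linarith [hb0 n]) hK
  let Z : Set (ℝ × ℝ × ℝ × (M.State → ℝ)) :=
    {p | M.IsBellman (p.2.1 * d) (p.2.1 * μ) p.1 (p.2.1 * p.2.2.1) p.2.2.2} ∩
      ({p | M.QConvex p.2.2.2} ∩ ((⋃ i, {p | p.2.2.2 i = 0}) ∩ ⋃ i, {p | p.2.2.2 i + p.2.1 = 1}))
  have hZ : IsClosed Z := by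
    refine (M.isClosed_isBellman d μ).inter (IsClosed.inter ?_ (IsClosed.inter ?_ ?_))
    · exact M.isClosed_qConvex.preimage (f := fun p : ℝ × ℝ × ℝ × (M.State → ℝ) => p.2.2.2)
        (by fun_prop)
    · exact isClosed_iUnion_of_finite fun i => isClosed_eq (by fun_prop) (by fun_prop)
    · exact isClosed_iUnion_of_finite fun i => isClosed_eq (by fun_prop) (by fun_prop)
  have hcomp : IsCompact (Icc (0 : ℝ) 1 ×ˢ Icc (0 : ℝ) 1 ×ˢ Icc (-K) K ×ˢ
      Icc (0 : M.State → ℝ) 1) :=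
    isCompact_Icc.prod (isCompact_Icc.prod (isCompact_Icc.prod isCompact_Icc))
  let p : ℕ → ℝ × ℝ × ℝ × (M.State → ℝ) := fun n => (1 - 1 / (n + 1), ρ n, κ n, ω n)
  obtain ⟨x, hx, φ, hφ, hlim⟩ := hcomp.tendsto_subseq (x := p) fun n =>
    ⟨⟨by linarith [hb1 n], by linarith [hb0 n]⟩, hρ n, hκ n, hω n⟩
  have hxZ : x ∈ Z := hZ.mem_of_tendsto hlim (Filter.Eventually.of_forall fun n =>
    ⟨hB _, hc _, mem_iUnion.2 (h0 _), mem_iUnion.2 (h1 _)⟩)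
  have hx1 : x.1 = 1 := by
    have l1 : Filter.Tendsto (fun n => (p (φ n)).1) Filter.atTop (nhds x.1) :=
      (continuous_fst.tendsto x).comp hlim
    have l2 : Filter.Tendsto (fun n => (p (φ n)).1) Filter.atTop (nhds (1 - 0)) :=
      (tendsto_const_nhds.sub tendsto_one_div_add_atTop_nhds_zero_nat).comp hφ.tendsto_atTop
    simpa using tendsto_nhds_unique l1 l2
  obtain ⟨b, r, k, w⟩ := x
  obtain ⟨hB', hc', h0', h1'⟩ := hxZ
  obtain ⟨i, hi⟩ := mem_iUnion.1 h0'
  obtain ⟨j, hj⟩ := mem_iUnion.1 h1'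
  simp only [mem_ofPred_eq] at hB' hc' hi hj hx1
  subst hx1
  have hr : 0 ≤ r := hx.2.1.1
  have hw := hx.2.2.2
  -- A vanishing scale would mean unbounded ranges, and leaves a cost-free limit attaining both 0
  -- and 1, which is impossible. A positive scale is divided out.
  rcases hr.eq_or_lt with hr0 | hr0
  · subst hr0
    simp only [zero_mul] at hB'
    exact (hB'.not_zero_one (fun i => hw.1 i) (fun i => hw.2 i) hi (by linarith)).elim
  · have key : ∀ i s, M.actionValue d μ 1 (fun i => r⁻¹ * w i + 0) i s =
        r⁻¹ * M.actionValue (r * d) (r * μ) 1 w i s := by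
      intro i s
      simp only [actionValue, expect_affine]
      field_simp
      ring
    refine ⟨k, fun i => r⁻¹ * w i + 0, fun i => ?_, fun a q hq => ?_⟩
    · have e : r⁻¹ * w i + 0 + k = r⁻¹ * (w i + r * k) := by field_simp; ring
      obtain ⟨g1, s, hs, g2⟩ := hB' i
      simp only [key, e]
      exact ⟨fun s hs => mul_le_mul_of_nonneg_left (g1 s hs) (inv_nonneg.2 hr), s, hs, by rw [g2]⟩
    · have := mul_le_mul_of_nonneg_left (hc' a q hq) (inv_nonneg.2 hr)
      simp only at this ⊢
      linarith

end AWGNLink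

namespace AWGNLink

variable {M : AWGNLink} {d μ g : ℝ} {h : M.State → ℝ} {σ τ : M.State → M.Rate}

/-! ### Optimal rates -/

/-- The rate `s` attains the minimum in the average-cost optimality equation. -/
def IsOptimal (M : AWGNLink) (d μ g : ℝ) (h : M.State → ℝ) (i : M.State) (s : M.Rate) : Prop :=
  M.Feasible i.1 s ∧ h i + g = M.actionValue d μ 1 h i s

/-- The two old values are both minimal, so an exchange that does not raise their sum must give
minimal values again. -/
theorem IsOptimal.exchange (hd : 0 ≤ d) (hB : M.IsBellman d μ 1 g h) (hc : M.QConvex h)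
    {i j : M.State} {s s' t t' : M.Rate} (hs : M.IsOptimal d μ g h i s)
    (hs' : M.IsOptimal d μ g h j s') (hij : j.2 = i.2) (hst : (t : ℕ) + t' = s + s')
    (ht : (s : ℕ) ≤ t ∧ (t : ℕ) ≤ s' ∨ (s' : ℕ) ≤ t ∧ (t : ℕ) ≤ s)
    (hu : (t : ℕ) ≤ s ∧ (i.1 : ℕ) + s' ≤ j.1 + t ∨ (j.1 : ℕ) + t ≤ i.1 + s' ∧ (s : ℕ) ≤ t) :
    M.IsOptimal d μ g h i t ∧ M.IsOptimal d μ g h j t' := by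
  obtain ⟨k1, k2, k3⟩ := AWGNLink.exchange (μ := μ) hd zero_le_one hc hs.1 hs'.1 (j₁ := i)
    (j₂ := j) (t₁ := t) (t₂ := t') hij rfl hij rfl hst ht (by omega)
  have l1 := (hB i).1 t k1
  have l2 := (hB j).1 t' k2
  have l3 := hs.2
  have l4 := hs'.2
  exact ⟨⟨k1, by linarith⟩, ⟨k2, by linarith⟩⟩

theorem exists_isOptimal_bounds (hB : M.IsBellman d μ 1 g h) (i : M.State) :
    (∃ s, M.IsOptimal d μ g h i s ∧ ∀ t, M.IsOptimal d μ g h i t → s ≤ t) ∧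
      ∃ s, M.IsOptimal d μ g h i s ∧ ∀ t, M.IsOptimal d μ g h i t → t ≤ s := by
  obtain ⟨s, hs⟩ := (hB i).2
  exact ⟨Set.exists_min_image {s | M.IsOptimal d μ g h i s} id (Set.toFinite _) ⟨s, hs⟩,
    Set.exists_max_image {s | M.IsOptimal d μ g h i s} id (Set.toFinite _) ⟨s, hs⟩⟩

/-- Optimal rates such that both the rate and the remaining queue are monotone in the queue. -/
structure IsMonotoneOptimal (M : AWGNLink) (d μ g : ℝ) (h : M.State → ℝ) (σ : M.State → M.Rate) :
    Prop where
  optimal : ∀ i, M.IsOptimal d μ g h i (σ i)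
  mono : ∀ i j, j.2 = i.2 → i.1 ≤ j.1 → σ i ≤ σ j
  rest_mono : ∀ i j, j.2 = i.2 → i.1 ≤ j.1 → (i.1 : ℕ) + σ j ≤ j.1 + σ i

theorem IsMonotoneOptimal.isSelector (hσ : M.IsMonotoneOptimal d μ g h σ) : M.IsSelector σ :=
  fun i => (hσ.optimal i).1

/-- A violation of monotonicity could be repaired by swapping the two rates, or the two remaining
queues, which would produce an optimal rate below the smallest. -/
theorem exists_min_rates (hd : 0 ≤ d) (hB : M.IsBellman d μ 1 g h) (hc : M.QConvex h) :
    ∃ σ, M.IsMonotoneOptimal d μ g h σ ∧ ∀ i t, M.IsOptimal d μ g h i t → σ i ≤ t := by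
  choose σ hσ hmin using fun i => (exists_isOptimal_bounds hB i).1
  refine ⟨σ, ⟨hσ, fun i j hij hle => ?_, fun i j hij hle => ?_⟩, hmin⟩
  · by_contra! hlt
    have hlt' := Fin.lt_def.1 hlt
    have hle' := Fin.le_def.1 hle
    have := hmin i _ (IsOptimal.exchange hd hB hc (hσ i) (hσ j) hij (t := σ j) (t' := σ i)
      (by omega) (by omega) (by omega)).1
    exact absurd this (not_le.2 hlt)
  · by_contra! hlt
    have f1 := (hσ i).1.1
    have f2 := (hσ j).1.1
    have hS := (σ j).2
    have := hmin j _ (IsOptimal.exchange hd hB hc (hσ i) (hσ j) hij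
      (t := ⟨i.1 + σ j - j.1, by omega⟩) (t' := ⟨j.1 + σ i - i.1, by omega⟩)
      (by simp only; omega) (by simp only; omega) (by simp only; omega)).2
    simp only [Fin.le_def] at this
    omega

theorem exists_max_rates (hd : 0 ≤ d) (hB : M.IsBellman d μ 1 g h) (hc : M.QConvex h) :
    ∃ σ, M.IsMonotoneOptimal d μ g h σ ∧ ∀ i t, M.IsOptimal d μ g h i t → t ≤ σ i := by
  choose σ hσ hmax using fun i => (exists_isOptimal_bounds hB i).2
  refine ⟨σ, ⟨hσ, fun i j hij hle => ?_, fun i j hij hle => ?_⟩, hmax⟩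
  · by_contra! hlt
    have hlt' := Fin.lt_def.1 hlt
    have hle' := Fin.le_def.1 hle
    have := hmax j _ (IsOptimal.exchange hd hB hc (hσ i) (hσ j) hij (t := σ j) (t' := σ i)
      (by omega) (by omega) (by omega)).2
    exact absurd this (not_le.2 hlt)
  · by_contra! hlt
    have f1 := (hσ i).1.1
    have f2 := (hσ j).1.1
    have hS := (σ j).2
    have := hmax i _ (IsOptimal.exchange hd hB hc (hσ i) (hσ j) hij
      (t := ⟨i.1 + σ j - j.1, by omega⟩) (t' := ⟨j.1 + σ i - i.1, by omega⟩)
      (by simp only; omega) (by simp only; omega) (by simp only; omega)).1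
    simp only [Fin.le_def] at this
    omega

theorem IsOptimal.of_between (hd : 0 ≤ d) (hB : M.IsBellman d μ 1 g h) (hc : M.QConvex h)
    {i : M.State} {s s' t : M.Rate} (hs : M.IsOptimal d μ g h i s)
    (hs' : M.IsOptimal d μ g h i s') (h1 : s ≤ t) (h2 : t ≤ s') : M.IsOptimal d μ g h i t := by
  have := s'.2
  simp only [Fin.le_def] at h1 h2
  exact (IsOptimal.exchange hd hB hc hs hs' rfl (t := t) (t' := ⟨s + s' - t, by omega⟩)
    (by simp only; omega) (by omega) (by omega)).1

/-- Below the largest optimal rates, some rate can be increased by one. -/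
theorem IsMonotoneOptimal.exists_raise (hd : 0 ≤ d) (hB : M.IsBellman d μ 1 g h)
    (hc : M.QConvex h) (hσ : M.IsMonotoneOptimal d μ g h σ) (hτ : M.IsMonotoneOptimal d μ g h τ)
    (hmax : ∀ i t, M.IsOptimal d μ g h i t → t ≤ τ i) (hne : σ ≠ τ) :
    ∃ (k : M.State) (s : M.Rate), (s : ℕ) = σ k + 1 ∧ s ≤ τ k ∧
      M.IsMonotoneOptimal d μ g h (Function.update σ k s) := by
  have hle : ∀ i, σ i ≤ τ i := fun i => hmax i _ (hσ.optimal i)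
  obtain ⟨i₀, hi₀⟩ := Function.ne_iff.1 hne
  let T : Set M.State := {i | σ i < τ i}
  obtain ⟨i₁, hi₁, hmin⟩ := Set.exists_min_image T σ (Set.toFinite _)
    ⟨i₀, lt_of_le_of_ne (hle i₀) hi₀⟩
  -- Among the states that can still be raised, take the least rate and then, for that rate and
  -- arrival number, the longest queue. Monotonicity of `τ` turns an obstruction above into a longer
  -- queue with the same rate, and one below into a raisable state with a smaller rate.
  obtain ⟨k, ⟨hk, hk1, hk2⟩, hkmax⟩ := Set.exists_max_image
    {i | i ∈ T ∧ i.2 = i₁.2 ∧ σ i = σ i₁} (fun i => i.1) (Set.toFinite _) ⟨i₁, hi₁, rfl, rfl⟩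
  have hk' : (σ k : ℕ) < τ k := hk
  have hτS := (τ k).2
  have hup : ∀ j, j.2 = k.2 → k.1 < j.1 → (σ k : ℕ) + 1 ≤ σ j := by
    intro j hj hlt
    have m1 := hσ.mono k j hj hlt.le
    have m2 := hτ.mono k j hj hlt.le
    by_contra! hcon
    simp only [Fin.le_def] at m1 m2
    have e : σ j = σ k := Fin.ext (by omega)
    have hjT : j ∈ T := Fin.lt_def.2 (by omega)
    have := hkmax j ⟨hjT, hj.trans hk1, e.trans hk2⟩
    omega
  have hdown : ∀ j, j.2 = k.2 → j.1 < k.1 → (j.1 : ℕ) + (σ k + 1) ≤ k.1 + σ j := by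
    intro j hj hlt
    have m1 := hσ.mono j k hj.symm hlt.le
    have m2 := hτ.rest_mono j k hj.symm hlt.le
    by_contra! hcon
    have m3 := hσ.rest_mono j k hj.symm hlt.le
    have hjT : j ∈ T := Fin.lt_def.2 (by omega)
    have m4 := hmin j hjT
    rw [← hk2] at m4
    simp only [Fin.le_def] at m1 m4
    have := Fin.lt_def.1 hlt
    omega
  refine ⟨k, ⟨σ k + 1, by omega⟩, rfl, Fin.le_def.2 (by simp only; omega), ?_, ?_, ?_⟩
  · intro i
    by_cases hi : i = k
    · subst hi
      rw [Function.update_self]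
      exact IsOptimal.of_between hd hB hc (hσ.optimal i) (hτ.optimal i)
        (Fin.le_def.2 (by simp only; omega)) (Fin.le_def.2 (by simp only; omega))
    · rw [Function.update_of_ne hi]
      exact hσ.optimal i
  · intro i j hij hle
    have m := hσ.mono i j hij hle
    by_cases hi : i = k <;> by_cases hj : j = k
    · rw [hi, hj]
    · subst hi
      rw [Function.update_self, Function.update_of_ne hj]
      have hlt : i.1 < j.1 := lt_of_le_of_ne hle fun e => hj (Prod.ext e.symm hij)
      exact Fin.le_def.2 (hup j hij hlt)
    · subst hj
      rw [Function.update_self, Function.update_of_ne hi]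
      simp only [Fin.le_def] at m ⊢
      omega
    · rwa [Function.update_of_ne hi, Function.update_of_ne hj]
  · intro i j hij hle
    have m := hσ.rest_mono i j hij hle
    by_cases hi : i = k <;> by_cases hj : j = k
    · rw [hi, hj]
    · subst hi
      rw [Function.update_self, Function.update_of_ne hj]
      simp only
      omega
    · subst hj
      rw [Function.update_self, Function.update_of_ne hi]
      have hlt : i.1 < j.1 := lt_of_le_of_ne hle fun e => hi (Prod.ext e hij.symm)
      exact hdown i hij.symm hlt
    · rwa [Function.update_of_ne hi, Function.update_of_ne hj]

/-! ### Unichain property of monotone optimal policies -/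

/-- Two closed sets of a monotone optimal policy cannot be a positive minimal distance apart:
they would be translates of each other, with the same power but different delays. -/
theorem IsMonotoneOptimal.no_translate (hμ : 0 < μ) (hσ : M.IsMonotoneOptimal d μ g h σ)
    {C D : Set M.State} (hC : M.Absorbing σ C) (hD : M.Absorbing σ D) {n : ℕ} (hn : 0 < n)
    (hmin : ∀ m : ℕ, ∀ i ∈ C, ∀ j ∈ D, j.2 = i.2 → (j.1 : ℕ) = i.1 + m → n ≤ m)
    {i₀ j₀ : M.State} (hi₀ : i₀ ∈ C) (hj₀ : j₀ ∈ D) (h2 : j₀.2 = i₀.2)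
    (h1 : (j₀.1 : ℕ) = i₀.1 + n) : False := by
  let T : Set M.State := {i | i ∈ C ∧ M.st (i.1 + n) i.2 ∈ D ∧ (i.1 : ℕ) + n ≤ M.Q}
  have hmk : ∀ i ∈ C, ∀ j ∈ D, j.2 = i.2 → (j.1 : ℕ) = i.1 + n → i ∈ T := by
    intro i hi j hj e2 e1
    refine ⟨hi, ?_, by omega⟩
    rw [← e1, ← e2, M.st_eta]
    exact hj
  -- At the least increment of `h` over the distance `n`, subtracting the two optimality equations
  -- makes this increment at least itself plus `μ * n`.
  obtain ⟨i, ⟨hi, hj, hQ⟩, himin⟩ := Set.exists_min_image T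
    (fun i => h (M.st (i.1 + n) i.2) - h i) (Set.toFinite _) ⟨i₀, hmk i₀ hi₀ j₀ hj₀ h2 h1⟩
  set j := M.st (i.1 + n) i.2 with hjdef
  have hj1 : (j.1 : ℕ) = i.1 + n := M.st_fst hQ _
  have hj2 : j.2 = i.2 := rfl
  have m1 := hσ.mono i j hj2 (Fin.le_def.2 (by omega))
  have m2 := hσ.rest_mono i j hj2 (Fin.le_def.2 (by omega))
  have fi := (hσ.isSelector i).1
  have fj := (hσ.isSelector j).1
  simp only [Fin.le_def] at m1
  -- By monotonicity the distance stays nonnegative and cannot grow in one step; by minimality it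
  -- cannot shrink, so the rates agree.
  have hss : σ j = σ i := by
    obtain ⟨a', ha⟩ := M.exists_γ_pos i.2
    have e1 := M.next_fst (hσ.isSelector i) a'
    have e2 := M.next_fst (hσ.isSelector j) a'
    have := hmin (j.1 - σ j - (i.1 - σ i)) _ (hC i hi a' ha) _ (hD j hj a' ha) rfl (by omega)
    exact Fin.ext (by omega)
  have hE : h j - h i ≤ M.expect h j (σ j) - M.expect h i (σ i) := by
    rw [← one_mul (h j - h i), ← M.γ_sum i.2, Finset.sum_mul, expect, expect,
      ← Finset.sum_sub_distrib]
    refine Finset.sum_le_sum fun a' _ => ?_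
    rw [hj2, ← mul_sub]
    rcases (M.γ_nonneg i.2 a').eq_or_lt with h0 | ha
    · rw [← h0, zero_mul, zero_mul]
    · refine mul_le_mul_of_nonneg_left ?_ ha.le
      have e1 := M.next_fst (hσ.isSelector i) a'
      have e2 := M.next_fst (hσ.isSelector j) a'
      have hd' : ((M.next j (σ j) a').1 : ℕ) = (M.next i (σ i) a').1 + n := by
        rw [hss] at e2 ⊢
        omega
      have := himin _ (hmk _ (hC i hi a' ha) _ (hD j hj a' ha) rfl hd')
      rw [← hd'] at this
      exact this.trans_eq (congrArg (fun k => h k - _) (M.st_eta (M.next j (σ j) a')))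
  have oi := (hσ.optimal i).2
  have oj := (hσ.optimal j).2
  simp only [actionValue, hss, hj1] at oi oj
  rw [hss] at hE
  push_cast at oj
  have hn' : (0 : ℝ) < n := by exact_mod_cast hn
  nlinarith

theorem IsMonotoneOptimal.meet (hμ : 0 < μ) (hσ : M.IsMonotoneOptimal d μ g h σ)
    {C D : Set M.State} (hC : M.Absorbing σ C) (hD : M.Absorbing σ D) (hCne : C.Nonempty)
    (hDne : D.Nonempty) : (C ∩ D).Nonempty := by
  classical
  by_contra hdisj
  have hex : ∃ n : ℕ, ∃ i ∈ C, ∃ j ∈ D, j.2 = i.2 ∧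
      ((j.1 : ℕ) = i.1 + n ∨ (i.1 : ℕ) = j.1 + n) := by
    obtain ⟨i, hi, hi0⟩ := hC.exists_mem hCne 0
    obtain ⟨j, hj, hj0⟩ := hD.exists_mem hDne 0
    rcases le_total (i.1 : ℕ) j.1 with h | h
    · exact ⟨j.1 - i.1, i, hi, j, hj, hj0.trans hi0.symm, Or.inl (by omega)⟩
    · exact ⟨i.1 - j.1, i, hi, j, hj, hj0.trans hi0.symm, Or.inr (by omega)⟩
  have hpos : 0 < Nat.find hex := by
    refine Nat.pos_of_ne_zero fun h0 => ?_
    obtain ⟨i, hi, j, hj, h1, h2⟩ := Nat.find_spec hex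
    rw [h0] at h2
    have : i = j := M.state_ext (by omega) h1.symm
    exact hdisj ⟨i, hi, this ▸ hj⟩
  obtain ⟨i, hi, j, hj, h1, h2 | h2⟩ := Nat.find_spec hex
  · exact hσ.no_translate hμ hC hD hpos
      (fun m i hi j hj e1 e2 => Nat.find_min' hex ⟨i, hi, j, hj, e1, Or.inl e2⟩) hi hj h1 h2
  · exact hσ.no_translate hμ hD hC hpos
      (fun m i hi j hj e1 e2 => Nat.find_min' hex ⟨j, hj, i, hi, e1.symm, Or.inr e2⟩) hj hi h1.symm
      h2

theorem IsMonotoneOptimal.isUnichain (hμ : 0 < μ) (hσ : M.IsMonotoneOptimal d μ g h σ) :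
    (M.detPolicy σ hσ.isSelector).IsUnichain :=
  Policy.isUnichain_of_meet _ fun _ _ hC hD hC' hD' =>
    hσ.meet hμ ((absorbing_iff _).1 hC') ((absorbing_iff _).1 hD') hC hD

/-! ### Coupling -/

/-- A stationary law of a finite system driven by the arrivals. -/
theorem exists_driven_stationary (M : AWGNLink) {Z : Type*} [Fintype Z] [Nonempty Z]
    (arr : Z → Fin (M.A + 1)) (nx : Z → Fin (M.A + 1) → Z) :
    ∃ v : Z → ℝ, (∀ z, 0 ≤ v z) ∧ ∑ z, v z = 1 ∧
      ∀ f : Z → ℝ, ∑ z, v z * ∑ a', M.γ (arr z) a' * f (nx z a') = ∑ z, v z * f z := by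
  classical
  let p : Z → Z → ℝ := fun z z' => ∑ a', if z' = nx z a' then M.γ (arr z) a' else 0
  have hp : ∀ z (f : Z → ℝ), ∑ z', p z z' * f z' = ∑ a', M.γ (arr z) a' * f (nx z a') := by
    intro z f
    simp only [p, Finset.sum_mul]
    rw [Finset.sum_comm]
    refine Finset.sum_congr rfl fun a' _ => ?_
    simp
  obtain ⟨v, hv0, hv1, hv⟩ := FiniteChain.exists_stationary (p := p)
    (fun z z' => Finset.sum_nonneg fun a' _ => by
      split_ifs
      exacts [M.γ_nonneg _ _, le_rfl])
    (fun z => by simpa [M.γ_sum] using hp z fun _ => 1)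
  refine ⟨v, hv0, hv1, fun f => ?_⟩
  simp only [← hp, Finset.mul_sum]
  refine Finset.sum_comm.trans ?_
  refine Finset.sum_congr rfl fun z' _ => ?_
  rw [← hv z', Finset.sum_mul]
  exact Finset.sum_congr rfl fun z _ => by ring

/-- A projection of the driven system that follows `τ` pushes its stationary law to one for `τ`;
arrivals of probability zero may be treated arbitrarily. -/
theorem exists_marginal (hτ : M.IsSelector τ) {Z : Type*} [Fintype Z] {arr : Z → Fin (M.A + 1)}
    {nx : Z → Fin (M.A + 1) → Z} {v : Z → ℝ} (hv0 : ∀ z, 0 ≤ v z) (hv1 : ∑ z, v z = 1)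
    (hv : ∀ f : Z → ℝ, ∑ z, v z * ∑ a', M.γ (arr z) a' * f (nx z a') = ∑ z, v z * f z)
    (m : Z → M.State) (hm : ∀ z, (m z).2 = arr z)
    (hnx : ∀ z a', 0 < M.γ (arr z) a' → m (nx z a') = M.next (m z) (τ (m z)) a') :
    ∃ π, (M.detPolicy τ hτ).IsStationary π ∧ ∀ f : M.State → ℝ,
      ∑ i, π i * f i = ∑ z, v z * f (m z) := by
  classical
  let π : M.State → ℝ := fun i => ∑ z, if i = m z then v z else 0
  have hπ : ∀ f : M.State → ℝ, ∑ i, π i * f i = ∑ z, v z * f (m z) := by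
    intro f
    simp only [π, Finset.sum_mul]
    rw [Finset.sum_comm]
    refine Finset.sum_congr rfl fun z _ => ?_
    simp
  refine ⟨π, (detPolicy_isStationary_iff hτ).2 ⟨fun i => Finset.sum_nonneg fun z _ => ?_, ?_,
    fun f => ?_⟩, hπ⟩
  · split_ifs
    exacts [hv0 z, le_rfl]
  · simpa [hv1] using hπ fun _ => 1
  · rw [hπ, hπ f, ← hv fun z => f (m z)]
    refine Finset.sum_congr rfl fun z _ => ?_
    rw [expect, hm]
    congr 1
    refine Finset.sum_congr rfl fun a' _ => ?_
    rcases (M.γ_nonneg (arr z) a').eq_or_lt with h0 | ha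
    · rw [← h0, zero_mul, zero_mul]
    · rw [hnx z a' ha]

/-- A policy that leaves less in the buffer has smaller mean queue length. -/
theorem mean_queue_le (hσ : M.IsSelector σ) (hτ : M.IsSelector τ)
    (uσ : (M.detPolicy σ hσ).IsUnichain) (uτ : (M.detPolicy τ hτ).IsUnichain)
    {K L : Set M.State} (hK : M.Absorbing σ K) (hL : M.Absorbing τ L)
    {i₀ j₀ : M.State} (hi₀ : i₀ ∈ K) (hj₀ : j₀ ∈ L) (h2 : j₀.2 = i₀.2) (h1 : i₀.1 ≤ j₀.1)
    (hle : ∀ i ∈ K, ∀ j ∈ L, j.2 = i.2 → i.1 ≤ j.1 → (i.1 : ℕ) + τ j ≤ j.1 + σ i)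
    {π ρ : M.State → ℝ} (hπ : (M.detPolicy σ hσ).IsStationary π)
    (hρ : (M.detPolicy τ hτ).IsStationary ρ) :
    ∑ i, (i.1 : ℝ) * π i ≤ ∑ i, (i.1 : ℝ) * ρ i := by
  classical
  -- Both policies run on the same arrivals; `hle` keeps their queues ordered. By the unichain
  -- hypotheses the marginals of a coupled stationary law are `π` and `ρ`.
  let Z := {z : M.State × M.State // z.1 ∈ K ∧ z.2 ∈ L ∧ z.2.2 = z.1.2 ∧ z.1.1 ≤ z.2.1}
  have : Nonempty Z := ⟨⟨(i₀, j₀), hi₀, hj₀, h2, h1⟩⟩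
  have hnx : ∀ (z : Z) (a' : Fin (M.A + 1)), ∃ z' : Z, 0 < M.γ z.1.1.2 a' →
      z'.1.1 = M.next z.1.1 (σ z.1.1) a' ∧ z'.1.2 = M.next z.1.2 (τ z.1.2) a' := by
    rintro ⟨⟨i, j⟩, hi, hj, e2, e1⟩ a'
    by_cases ha : 0 < M.γ i.2 a'
    · refine ⟨⟨(M.next i (σ i) a', M.next j (τ j) a'), hK i hi a' ha, hL j hj a' (e2 ▸ ha), rfl,
        ?_⟩, fun _ => ⟨rfl, rfl⟩⟩
      have := hle i hi j hj e2 e1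
      have := (hσ i).1
      have := (hτ j).1
      simp only at this ⊢
      rw [Fin.le_def, M.next_fst (hσ i), M.next_fst (hτ j)]
      omega
    · exact ⟨⟨(i, j), hi, hj, e2, e1⟩, fun h => (ha h).elim⟩
  choose nx hnx using hnx
  obtain ⟨v, hv0, hv1, hv⟩ := M.exists_driven_stationary (fun z : Z => z.1.1.2) nx
  obtain ⟨π', hπ', eπ⟩ := exists_marginal hσ hv0 hv1 hv (fun z : Z => z.1.1) (fun _ => rfl)
    fun z a' ha => (hnx z a' ha).1
  obtain ⟨ρ', hρ', eρ⟩ := exists_marginal hτ hv0 hv1 hv (fun z : Z => z.1.2)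
    (fun z => z.2.2.2.1) fun z a' ha => (hnx z a' ha).2
  rw [uσ.stationary_unique hπ hπ', uτ.stationary_unique hρ hρ']
  simp only [mul_comm _ (π' _), mul_comm _ (ρ' _)]
  rw [eπ fun i => (i.1 : ℝ), eρ fun i => (i.1 : ℝ)]
  refine Finset.sum_le_sum fun z _ => mul_le_mul_of_nonneg_left ?_ (hv0 z)
  exact_mod_cast z.2.2.2.2

/-! ### Weighted cost -/

/-- The relative values cancel by balance, so the cost exceeds `g` by the average slack in the
optimality equation. Hence `g` is a lower bound, attained only with optimal rates on the support.
The factor `1 / M.α` converts the weight of the delay into one of the queue. -/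
theorem weighted_cost_eq {x : M.State → M.Rate → ℝ} (hx : x ∈ M.frequencies) (p g : ℝ) :
    d * M.power x + p * M.delay x = g +
      ∑ i, ∑ s, x i s * (M.actionValue d (p * (1 / M.α)) 1 h i s - (h i + g)) := by
  have hE := sum_expect_of_mem_frequencies hx h
  have e : ∑ i, ∑ s, x i s * (M.actionValue d (p * (1 / M.α)) 1 h i s - (h i + g)) =
      d * M.power x + p * M.delay x + (∑ i, ∑ s, x i s * M.expect h i s -
        ∑ i, ∑ s, x i s * h i) - g * ∑ i, ∑ s, x i s := by
    simp only [power, delay, actionValue, Finset.mul_sum, ← Finset.sum_add_distrib,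
      ← Finset.sum_sub_distrib]
    exact Finset.sum_congr rfl fun i _ => Finset.sum_congr rfl fun s _ => by ring
  rw [e, hE, hx.2.1]
  ring

theorem term_nonneg (hB : M.IsBellman d μ 1 g h) {x : M.State → M.Rate → ℝ}
    (hx : x ∈ M.frequencies) (i : M.State) (s : M.Rate) :
    0 ≤ x i s * (M.actionValue d μ 1 h i s - (h i + g)) := by
  by_cases hs : M.Feasible i.1 s
  · exact mul_nonneg (hx.2.2.1 i s) (sub_nonneg.2 ((hB i).1 s hs))
  · rw [hx.2.2.2 i s hs, zero_mul]

theorem gain_le {p : ℝ} (hB : M.IsBellman d (p * (1 / M.α)) 1 g h) {x : M.State → M.Rate → ℝ}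
    (hx : x ∈ M.frequencies) : g ≤ d * M.power x + p * M.delay x := by
  rw [weighted_cost_eq (h := h) hx p g]
  exact le_add_of_nonneg_right
    (Finset.sum_nonneg fun i _ => Finset.sum_nonneg fun s _ => term_nonneg hB hx i s)

theorem isOptimal_of_cost_eq {p : ℝ} (hB : M.IsBellman d (p * (1 / M.α)) 1 g h)
    {x : M.State → M.Rate → ℝ} (hx : x ∈ M.frequencies)
    (hg : d * M.power x + p * M.delay x = g) {i : M.State} {s : M.Rate} (his : 0 < x i s) :
    M.IsOptimal d (p * (1 / M.α)) g h i s := by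
  rw [weighted_cost_eq (h := h) hx p g] at hg
  have h0 : ∑ i, ∑ s, x i s * (M.actionValue d (p * (1 / M.α)) 1 h i s - (h i + g)) = 0 := by
    linarith
  rw [Finset.sum_eq_zero_iff_of_nonneg fun i _ => Finset.sum_nonneg fun s _ =>
    term_nonneg hB hx i s] at h0
  have h1 := h0 i (Finset.mem_univ i)
  rw [Finset.sum_eq_zero_iff_of_nonneg fun s _ => term_nonneg hB hx i s] at h1
  have h2 := (mul_eq_zero.1 (h1 s (Finset.mem_univ s))).resolve_left his.ne'
  exact ⟨by_contra fun hs => his.ne' (hx.2.2.2 i s hs), by linarith⟩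

theorem IsMonotoneOptimal.cost_eq {p : ℝ}
    (hσ : M.IsMonotoneOptimal d (p * (1 / M.α)) g h σ) {z : ℝ × ℝ}
    (hz : (M.detPolicy σ hσ.isSelector).Obtains z) : d * z.1 + p * z.2 = g := by
  obtain ⟨π, hπ, rfl⟩ := (Policy.obtains_iff _).1 hz
  simp only [Policy.pair]
  rw [weighted_cost_eq (h := h) hπ.mem_frequencies p g, add_eq_left]
  refine Finset.sum_eq_zero fun i _ => Finset.sum_eq_zero fun s _ => ?_
  by_cases hs : s = σ i
  · rw [hs, (hσ.optimal i).2, sub_self, mul_zero]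
  · simp [detPolicy, hs]

end AWGNLink

namespace AWGNLink

variable {M : AWGNLink} {d p g : ℝ} {h : M.State → ℝ} {σ τ : M.State → M.Rate} {z w y : ℝ × ℝ}

/-! ### Minimal delay -/

/-- The arrival marginal of `x` is invariant under `γ`, hence equal to `φ`. -/
theorem sum_arrival_of_mem_frequencies {x : M.State → M.Rate → ℝ} (hx : x ∈ M.frequencies)
    (G : Fin (M.A + 1) → ℝ) : ∑ i, ∑ s, x i s * G i.2 = ∑ a, M.φ a * G a := by
  classical
  let ψ : Fin (M.A + 1) → ℝ := fun a => ∑ i, ∑ s, x i s * if a = i.2 then 1 else 0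
  have hψ : ∀ G : Fin (M.A + 1) → ℝ, ∑ a, ψ a * G a = ∑ i, ∑ s, x i s * G i.2 := by
    intro G
    simp only [ψ, Finset.sum_mul]
    refine Finset.sum_comm.trans (Finset.sum_congr rfl fun i _ => ?_)
    refine Finset.sum_comm.trans (Finset.sum_congr rfl fun s _ => ?_)
    simp
  have hφ : ψ = M.φ := by
    refine M.eq_φ_of_invariant ?_ fun a' => ?_
    · simpa [hx.2.1] using hψ fun _ => 1
    · rw [hψ fun a => M.γ a a']
      have hE : ∀ (i : M.State) (s : M.Rate),
          M.expect (fun i => if a' = i.2 then 1 else 0) i s = M.γ i.2 a' := fun i s => by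
        rw [expect, Finset.sum_eq_single a']
        · rw [next_snd, if_pos rfl, mul_one]
        · exact fun b _ hb => by rw [next_snd, if_neg hb.symm, mul_zero]
        · simp
      have := sum_expect_of_mem_frequencies hx fun i => if a' = i.2 then 1 else 0
      simp only [hE] at this
      exact this
  rw [← hψ, hφ]

/-- Emptying the buffer in each slot gives mean queue `α`. In general the mean queue is `α` plus the
mean remainder, so minimal delay forces the buffer to be emptied and the power to be that of the
arrivals. -/
theorem power_eq_of_min_delay {x : M.State → M.Rate → ℝ} (hx : x ∈ M.frequencies)
    (hmin : ∀ y ∈ M.obtainable, M.delay x ≤ y.2) : M.power x = ∑ a, M.φ a * M.P a := by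
  classical
  have hα := M.α_pos
  have hmean : ∑ i : M.State, ∑ s : M.Rate, x i s * (i.1 : ℝ) ≤ M.α := by
    let σ : M.State → M.Rate := fun i => ⟨min i.1 M.S, by omega⟩
    have hσ : M.IsSelector σ := fun i => by
      have := M.A_le_S
      have := M.A_le_Q
      exact ⟨by simp only [σ]; omega, by simp only [σ]; omega⟩
    have hC : M.Absorbing σ {i | (i.1 : ℕ) = i.2} := by
      intro i hi a' _
      simp only [mem_ofPred_eq] at hi ⊢
      have := M.A_le_S
      rw [M.next_fst (hσ i), next_snd]
      simp only [σ]
      omega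
    obtain ⟨π, hπ, hπ0⟩ := hC.exists_stationary hσ ⟨M.st 0 0, by simp [st]⟩
    have h1 := hmin _ ⟨_, hπ.mem_frequencies, rfl⟩
    have h2 := (M.detPolicy σ hσ).pair_snd π
    have h3 := sum_arrival_of_mem_frequencies hπ.mem_frequencies fun a => (a : ℝ)
    have h4 : ∑ i : M.State, (i.1 : ℝ) * π i = M.α := by
      have e : M.α = ∑ a, M.φ a * (a : ℝ) := Finset.sum_congr rfl fun a _ => mul_comm _ _
      rw [e, ← h3]
      refine Finset.sum_congr rfl fun i _ => ?_
      rw [← Finset.sum_mul, ← Finset.mul_sum, (M.detPolicy σ hσ).sum_one, mul_one]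
      by_cases hi : (i.1 : ℕ) = i.2
      · rw [hi, mul_comm]
      · rw [hπ0 i hi, zero_mul, mul_zero]
    rw [h4] at h2
    simp only [Policy.pair] at h2
    rw [h2] at h1
    have h5 := (mul_le_mul_iff_of_pos_left (one_div_pos.2 hα)).1 h1
    simpa only [mul_comm] using h5
  have hsupp : ∀ i s, 0 < x i s → (i.1 : ℕ) = s := by
    have e1 := sum_expect_of_mem_frequencies hx fun i => (i.1 : ℝ)
    have e2 : ∑ i : M.State, ∑ s : M.Rate, x i s * M.expect (fun i => (i.1 : ℝ)) i s =
        ∑ i : M.State, ∑ s : M.Rate, x i s * ((i.1 : ℝ) - s) + M.α := by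
      have e3 := sum_expect_of_mem_frequencies hx fun i => (i.2 : ℝ)
      have e4 := sum_arrival_of_mem_frequencies hx fun a => (a : ℝ)
      have e : M.α = ∑ a, M.φ a * (a : ℝ) := Finset.sum_congr rfl fun a _ => mul_comm _ _
      rw [e, ← e4, ← e3]
      simp only [← Finset.sum_add_distrib]
      refine Finset.sum_congr rfl fun i _ => Finset.sum_congr rfl fun s _ => ?_
      by_cases hs : M.Feasible i.1 s
      · rw [← mul_add]
        congr 1
        rw [← M.expect_const ((i.1 : ℝ) - s) i s]
        simp only [expect, ← Finset.sum_add_distrib, ← mul_add]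
        refine Finset.sum_congr rfl fun a' _ => ?_
        rw [M.next_fst hs a']
        push_cast [Nat.cast_sub hs.1]
        rfl
      · simp [hx.2.2.2 i s hs]
    have hn : ∀ i s, 0 ≤ x i s * ((i.1 : ℝ) - (s : ℕ)) := by
      intro i s
      by_cases hs : M.Feasible i.1 s
      · exact mul_nonneg (hx.2.2.1 i s) (sub_nonneg.2 (by exact_mod_cast hs.1))
      · rw [hx.2.2.2 i s hs, zero_mul]
    have h0 : ∑ i : M.State, ∑ s : M.Rate, x i s * ((i.1 : ℝ) - (s : ℕ)) = 0 := by
      refine le_antisymm ?_ (Finset.sum_nonneg fun i _ => Finset.sum_nonneg fun s _ => hn i s)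
      linarith
    intro i s his
    rw [Finset.sum_eq_zero_iff_of_nonneg fun i _ => Finset.sum_nonneg fun s _ => hn i s] at h0
    have h1 := h0 i (Finset.mem_univ i)
    rw [Finset.sum_eq_zero_iff_of_nonneg fun s _ => hn i s] at h1
    have h2 := (mul_eq_zero.1 (h1 s (Finset.mem_univ s))).resolve_left his.ne'
    exact_mod_cast sub_eq_zero.1 h2
  have e1 := sum_expect_of_mem_frequencies hx fun i => M.P i.1
  have e2 := sum_expect_of_mem_frequencies hx fun i => M.P i.2
  have e3 := sum_arrival_of_mem_frequencies hx fun a => M.P a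
  rw [← e3, ← e2]
  refine Eq.trans ?_ (e1.symm.trans ?_)
  · refine Finset.sum_congr rfl fun i _ => Finset.sum_congr rfl fun s _ => ?_
    rcases (hx.2.2.1 i s).eq_or_lt with h0 | h0
    · rw [← h0, mul_zero, zero_mul]
    · rw [hsupp i s h0, mul_comm]
  · refine Finset.sum_congr rfl fun i _ => Finset.sum_congr rfl fun s _ => ?_
    rcases (hx.2.2.1 i s).eq_or_lt with h0 | h0
    · rw [← h0, zero_mul, zero_mul]
    · congr 1
      refine Finset.sum_congr rfl fun a' _ => ?_
      have hs : M.Feasible i.1 s := by_contra fun hs => h0.ne' (hx.2.2.2 i s hs)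
      beta_reduce
      rw [M.next_fst hs a', hsupp i s h0, Nat.sub_self, zero_add, next_snd]

/-! ### Edges of the curve -/

theorem snd_le_of_segment_subset (hzw : z.1 < w.1) (hseg : segment ℝ z w ⊆ M.curve) :
    w.2 ≤ z.2 :=
  ((hseg (right_mem_segment ℝ z w)).2 z (hseg (left_mem_segment ℝ z w)).1).resolve_left
    (not_le.2 hzw)

/-- The line through an edge of the curve supports the set of obtainable pairs. -/
theorem supporting (hzw : z.1 < w.1) (hseg : segment ℝ z w ⊆ M.curve) (hy : y ∈ M.obtainable) :
    (z.2 - w.2) * z.1 + (w.1 - z.1) * z.2 ≤ (z.2 - w.2) * y.1 + (w.1 - z.1) * y.2 := by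
  have hd : 0 ≤ z.2 - w.2 := sub_nonneg.2 (snd_le_of_segment_subset hzw hseg)
  have hp : 0 < w.1 - z.1 := sub_pos.2 hzw
  generalize hd' : z.2 - w.2 = d at *
  generalize hp' : w.1 - z.1 = p at *
  by_contra! hlt
  obtain ⟨t, ht⟩ : ∃ t, y.1 = z.1 + t * p := ⟨(y.1 - z.1) / p, by field_simp; ring⟩
  obtain ⟨δ, hδ⟩ : ∃ δ, y.2 = z.2 - t * d - δ := ⟨z.2 - t * d - y.2, by ring⟩
  have hδ0 : 0 < δ := by
    rw [ht, hδ] at hlt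
    by_contra! hle
    nlinarith
  -- Moving from the midpoint of the edge by `ε` towards `y` goes below the line by `ε * δ`. The
  -- point of the edge shifted by a further `η` has more power, and still more delay because `η * d
  -- < ε * δ`, so it is strictly dominated.
  obtain ⟨ε, hε0, hε1, hε2⟩ : ∃ ε : ℝ, 0 < ε ∧ ε ≤ 1 / 4 ∧ |ε * (t - 1 / 2)| ≤ 1 / 4 := by
    refine ⟨1 / (4 * (|t - 1 / 2| + 1)), by positivity, ?_, ?_⟩
    · rw [div_le_div_iff₀ (by positivity) (by norm_num)]
      linarith [abs_nonneg (t - 1 / 2)]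
    · rw [abs_mul, abs_of_pos (by positivity), one_div_mul_eq_div,
        div_le_div_iff₀ (by positivity) (by norm_num)]
      linarith
  obtain ⟨η, hη0, hη1, hη2⟩ : ∃ η : ℝ, 0 < η ∧ η ≤ 1 / 4 ∧ η * d < ε * δ := by
    refine ⟨min (1 / 4) (ε * δ / (d + 1)), lt_min (by norm_num) (by positivity), min_le_left _ _, ?_⟩
    have h1 : min (1 / 4) (ε * δ / (d + 1)) * d ≤ ε * δ / (d + 1) * d :=
      mul_le_mul_of_nonneg_right (min_le_right _ _) hd
    refine h1.trans_lt ?_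
    rw [div_mul_eq_mul_div, div_lt_iff₀ (by positivity)]
    have := mul_pos hε0 hδ0
    linarith
  obtain ⟨hl, hr⟩ := abs_le.1 hε2
  have hO : ∀ u ∈ segment ℝ z w, u ∈ M.obtainable := fun u hu => (hseg hu).1
  have hmid : ((1 / 2 : ℝ) • z + (1 / 2 : ℝ) • w) ∈ segment ℝ z w :=
    ⟨1 / 2, 1 / 2, by norm_num, by norm_num, by norm_num, rfl⟩
  have hcand := M.convex_obtainable (hO _ hmid) hy (show 0 ≤ 1 - ε by linarith) hε0.le (by ring)
  have hs : ((1 - (1 / 2 + ε * (t - 1 / 2) + η)) • z + (1 / 2 + ε * (t - 1 / 2) + η) • w) ∈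
      segment ℝ z w := ⟨_, _, by linarith, by linarith, by ring, rfl⟩
  have hw1 : w.1 = z.1 + p := by linarith
  have hw2 : w.2 = z.2 - d := by linarith
  rcases (hseg hs).2 _ hcand with h1 | h1
  · simp only [Prod.fst_add, Prod.smul_fst, smul_eq_mul, ht, hw1] at h1
    nlinarith [mul_pos hη0 hp]
  · simp only [Prod.snd_add, Prod.smul_snd, smul_eq_mul, hδ, hw2] at h1
    nlinarith

theorem snd_lt_of_segment_subset (hzw : z.1 < w.1) (hseg : segment ℝ z w ⊆ M.curve) :
    w.2 < z.2 := by
  refine lt_of_le_of_ne (snd_le_of_segment_subset hzw hseg) fun he => ?_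
  have hmin : ∀ y ∈ M.obtainable, z.2 ≤ y.2 := by
    intro y hy
    have := supporting hzw hseg hy
    rw [he, sub_self, zero_mul, zero_mul, zero_add, zero_add] at this
    exact le_of_mul_le_mul_left this (sub_pos.2 hzw)
  obtain ⟨x, hx, hzx⟩ := (hseg (left_mem_segment ℝ z w)).1
  obtain ⟨x', hx', hwx⟩ := (hseg (right_mem_segment ℝ z w)).1
  have hz2 : z.2 = M.delay x := congrArg Prod.snd hzx
  have hw2 : w.2 = M.delay x' := congrArg Prod.snd hwx
  have e1 := power_eq_of_min_delay hx fun y hy => hz2 ▸ hmin y hy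
  have e2 := power_eq_of_min_delay hx' fun y hy => hw2 ▸ he ▸ hmin y hy
  have : z.1 = w.1 := by
    rw [hzx, hwx]
    exact e1.trans e2.symm
  exact hzw.ne this

/-- Obtainable points on the line through two extreme points lie between them. -/
theorem mem_segment_of_line (hz : z ∈ M.obtainable.extremePoints ℝ)
    (hw : w ∈ M.obtainable.extremePoints ℝ) (hzw : z.1 < w.1) (hy : y ∈ M.obtainable)
    (hline : (z.2 - w.2) * y.1 + (w.1 - z.1) * y.2 = (z.2 - w.2) * z.1 + (w.1 - z.1) * z.2) :
    y ∈ segment ℝ z w := by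
  have hp : 0 < w.1 - z.1 := sub_pos.2 hzw
  obtain ⟨t, ht⟩ : ∃ t, y.1 = z.1 + t * (w.1 - z.1) :=
    ⟨(y.1 - z.1) / (w.1 - z.1), by field_simp; ring⟩
  have ht2 : y.2 = z.2 + t * (w.2 - z.2) := by
    rw [ht] at hline
    refine mul_left_cancel₀ hp.ne' ?_
    linarith
  have hyt : y = (1 - t) • z + t • w := by
    ext
    · simp only [Prod.fst_add, Prod.smul_fst, smul_eq_mul, ht]; ring
    · simp only [Prod.snd_add, Prod.smul_snd, smul_eq_mul, ht2]; ring
  rcases lt_or_ge t 0 with h0 | h0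
  · have h1 : 0 < 1 - t := by linarith
    have : z ∈ openSegment ℝ y w := by
      refine ⟨1 / (1 - t), -t / (1 - t), by positivity, div_pos (by linarith) h1,
        by field_simp; ring, ?_⟩
      ext
      · simp only [Prod.fst_add, Prod.smul_fst, smul_eq_mul, ht]; field_simp; ring
      · simp only [Prod.snd_add, Prod.smul_snd, smul_eq_mul, ht2]; field_simp; ring
    rw [hz.2 hy hw.1 this]
    exact left_mem_segment ℝ z w
  rcases lt_or_ge 1 t with h1 | h1
  · have : w ∈ openSegment ℝ y z := by
      refine ⟨1 / t, (t - 1) / t, by positivity, div_pos (by linarith) (by linarith),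
        by field_simp; ring, ?_⟩
      ext
      · simp only [Prod.fst_add, Prod.smul_fst, smul_eq_mul, ht]; field_simp; ring
      · simp only [Prod.snd_add, Prod.smul_snd, smul_eq_mul, ht2]; field_simp; ring
    rw [hw.2 hy hz.1 this]
    exact right_mem_segment ℝ z w
  · exact ⟨1 - t, t, by linarith, h0, by ring, hyt.symm⟩

/-! ### Policies along an edge -/

theorem absorbing_univ (σ : M.State → M.Rate) : M.Absorbing σ univ := fun _ _ _ _ => mem_univ _

theorem exists_obtains (hσ : M.IsSelector σ) : ∃ y, (M.detPolicy σ hσ).Obtains y := by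
  obtain ⟨π, hπ, -⟩ := (absorbing_univ σ).exists_stationary hσ ⟨M.st 0 0, mem_univ _⟩
  exact ⟨_, (Policy.obtains_iff _).2 ⟨π, hπ, rfl⟩⟩

theorem Policy.IsUnichain.obtains_unique {F : M.Policy} (hF : F.IsUnichain) (hz : F.Obtains z)
    (hw : F.Obtains w) : z = w := by
  obtain ⟨π, hπ, rfl⟩ := F.obtains_iff.1 hz
  obtain ⟨π', hπ', rfl⟩ := F.obtains_iff.1 hw
  rw [hF.stationary_unique hπ hπ']

theorem absorbing_support (hσ : M.IsSelector σ) {π : M.State → ℝ}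
    (hπ : (M.detPolicy σ hσ).IsStationary π) : M.Absorbing σ {i | 0 < π i} :=
  (absorbing_iff hσ).1 fun _ hi _ hij =>
    FiniteChain.pos_of_invariant (Policy.trans_nonneg _) hπ.1 hπ.2.2 hi hij

theorem support_nonempty {F : M.Policy} {π : M.State → ℝ} (hπ : F.IsStationary π) :
    {i | 0 < π i}.Nonempty := by
  by_contra h
  have : ∑ i, π i ≤ 0 := Finset.sum_nonpos fun i _ => not_lt.1 fun hi => h ⟨i, hi⟩
  linarith [hπ.2.1]

theorem isOptimal_of_obtains {σ : M.State → M.Rate} (hσ : M.IsSelector σ)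
    (hB : M.IsBellman d (p * (1 / M.α)) 1 g h) {π : M.State → ℝ}
    (hπ : (M.detPolicy σ hσ).IsStationary π)
    (hg : d * ((M.detPolicy σ hσ).pair π).1 + p * ((M.detPolicy σ hσ).pair π).2 = g)
    {i : M.State} (hi : 0 < π i) : M.IsOptimal d (p * (1 / M.α)) g h i (σ i) :=
  isOptimal_of_cost_eq hB hπ.mem_frequencies hg (by simpa [detPolicy] using hi)

theorem oneStateStep_update (hσ : M.IsSelector σ) {k : M.State} {s : M.Rate} (hs : s ≠ σ k)
    (hσ' : M.IsSelector (Function.update σ k s)) (u : (M.detPolicy σ hσ).IsUnichain)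
    (u' : (M.detPolicy _ hσ').IsUnichain) (hy : (M.detPolicy σ hσ).Obtains y)
    (hz : (M.detPolicy _ hσ').Obtains z) : M.OneStateStep y z := by
  refine ⟨_, _, detPolicy_isDeterministic hσ, u, hy, detPolicy_isDeterministic hσ', u', hz, k,
    fun e => ?_, fun i hi => ?_⟩
  · have := congrFun e s
    simp [detPolicy, hs] at this
  · by_contra hne
    exact hi (funext fun t => by simp [detPolicy, Function.update_of_ne hne])

theorem snd_le_of_mean_queue_le {F F' : M.Policy} {π ρ : M.State → ℝ}
    (hle : ∑ i : M.State, (i.1 : ℝ) * π i ≤ ∑ i : M.State, (i.1 : ℝ) * ρ i) :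
    (F.pair π).2 ≤ (F'.pair ρ).2 := by
  rw [F.pair_snd, F'.pair_snd]
  exact mul_le_mul_of_nonneg_left hle (one_div_pos.2 M.α_pos).le

/-- From monotone optimal rates, raising one rate at a time leads along the edge. -/
theorem IsMonotoneOptimal.exists_chain (hd : 0 < d) (hp : 0 < p)
    (hB : M.IsBellman d (p * (1 / M.α)) 1 g h) (hc : M.QConvex h)
    (hτ : M.IsMonotoneOptimal d (p * (1 / M.α)) g h τ)
    (hmax : ∀ i t, M.IsOptimal d (p * (1 / M.α)) g h i t → t ≤ τ i)
    (hw : (M.detPolicy τ hτ.isSelector).Obtains w)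
    (hseg : ∀ y ∈ M.obtainable, d * y.1 + p * y.2 = g → y ∈ segment ℝ z w) (m : ℕ) :
    ∀ (σ : M.State → M.Rate) (hσ : M.IsMonotoneOptimal d (p * (1 / M.α)) g h σ) (y : ℝ × ℝ),
      (M.detPolicy σ hσ.isSelector).Obtains y → ∑ i, ((τ i : ℕ) - (σ i : ℕ)) = m →
      ∃ (n : ℕ) (v : ℕ → ℝ × ℝ), v 0 = y ∧ v n = w ∧ (∀ k ≤ n, v k ∈ segment ℝ z w) ∧
        ∀ k < n, (v k).1 < (v (k + 1)).1 ∧ M.OneStateStep (v k) (v (k + 1)) := by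
  have hμ : 0 < p * (1 / M.α) := mul_pos hp (one_div_pos.2 M.α_pos)
  induction m using Nat.strong_induction_on with
  | _ m ih =>
    intro σ hσ y hy hm
    by_cases hne : σ = τ
    · subst hne
      have : y = w := (hσ.isUnichain hμ).obtains_unique hy hw
      exact ⟨0, fun _ => w, this.symm, rfl, fun _ _ => right_mem_segment ℝ z w,
        fun k hk => (Nat.not_lt_zero k hk).elim⟩
    · obtain ⟨k, s, hs, hsτ, hσ'⟩ := hσ.exists_raise hd.le hB hc hτ hmax hne
      obtain ⟨y', hy'⟩ := exists_obtains hσ'.isSelector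
      have hsum : ∑ i, ((τ i : ℕ) - (Function.update σ k s i : ℕ)) < m := by
        rw [← hm]
        simp only [Fin.le_def] at hsτ
        refine Finset.sum_lt_sum (fun i _ => ?_) ⟨k, Finset.mem_univ k, ?_⟩
        · by_cases hi : i = k
          · subst hi
            rw [Function.update_self]
            omega
          · rw [Function.update_of_ne hi]
        · rw [Function.update_self]
          omega
      obtain ⟨n, v, v0, vn, vseg, vstep⟩ := ih _ hsum _ hσ' y' hy' rfl
      -- Raising a rate in a transient state, for instance, leaves the point unchanged; such a step
      -- is omitted from the chain.
      by_cases hyy : y' = y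
      · exact ⟨n, v, v0.trans hyy, vn, vseg, vstep⟩
      have hc1 := hσ.cost_eq hy
      have hc2 := hσ'.cost_eq hy'
      have h2 : y'.2 ≤ y.2 := by
        obtain ⟨π, hπ, rfl⟩ := (Policy.obtains_iff _).1 hy
        obtain ⟨π', hπ', rfl⟩ := (Policy.obtains_iff _).1 hy'
        refine snd_le_of_mean_queue_le (mean_queue_le _ _ (hσ'.isUnichain hμ) (hσ.isUnichain hμ)
          (absorbing_univ _) (absorbing_univ _) (mem_univ (M.st 0 0)) (mem_univ _) rfl le_rfl
          (fun i _ j _ hij hle => ?_) hπ' hπ)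
        have h1 := hσ.rest_mono i j hij hle
        by_cases hi : i = k
        · subst hi
          rw [Function.update_self]
          omega
        · rwa [Function.update_of_ne hi]
      have h1 : y.1 < y'.1 := by
        by_contra! hle
        have e2 : y'.2 = y.2 := by nlinarith
        have e1 : y'.1 = y.1 := by
          refine mul_left_cancel₀ hd.ne' ?_
          rw [e2] at hc2
          linarith
        exact hyy (Prod.ext e1 e2)
      refine ⟨n + 1, fun k => Nat.casesOn k y v, rfl, vn, fun k hk => ?_, fun k hk => ?_⟩
      · cases k with
        | zero => exact hseg y hy.mem_obtainable hc1
        | succ k => exact vseg k (by omega)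
      · cases k with
        | zero =>
          simp only [v0]
          refine ⟨h1, oneStateStep_update hσ.isSelector (k := k) (s := s) ?_ hσ'.isSelector
            (hσ.isUnichain hμ) (hσ'.isUnichain hμ) hy hy'⟩
          intro e
          rw [e] at hs
          omega
        | succ k => exact vstep k (by omega)

/-- Extreme points that span an edge are joined by policies differing in one state at a time. -/
theorem exists_chain (hz : z ∈ M.obtainable.extremePoints ℝ)
    (hw : w ∈ M.obtainable.extremePoints ℝ) (hzw : z.1 < w.1) (hseg : segment ℝ z w ⊆ M.curve) :
    ∃ (n : ℕ) (v : ℕ → ℝ × ℝ), v 0 = z ∧ v n = w ∧ (∀ k ≤ n, v k ∈ segment ℝ z w) ∧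
      ∀ k < n, (v k).1 < (v (k + 1)).1 ∧ M.OneStateStep (v k) (v (k + 1)) := by
  have hd : 0 < z.2 - w.2 := sub_pos.2 (snd_lt_of_segment_subset hzw hseg)
  have hp : 0 < w.1 - z.1 := sub_pos.2 hzw
  have hsupp := fun y hy => supporting (y := y) hzw hseg hy
  have hline := fun y hy => mem_segment_of_line (y := y) hz hw hzw hy
  have hcw : (z.2 - w.2) * w.1 + (w.1 - z.1) * w.2 = (z.2 - w.2) * z.1 + (w.1 - z.1) * z.2 := by
    ring
  generalize hd' : z.2 - w.2 = d at *
  generalize hp' : w.1 - z.1 = p at *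
  have hμ : 0 < p * (1 / M.α) := mul_pos hp (one_div_pos.2 M.α_pos)
  obtain ⟨g, h, hB, hc⟩ := M.exists_isBellman (d := d) (μ := p * (1 / M.α)) hd.le
  obtain ⟨σ, hσ, hmin⟩ := exists_min_rates hd.le hB hc
  obtain ⟨τ, hτ, hmax⟩ := exists_max_rates hd.le hB hc
  obtain ⟨y, hy⟩ := exists_obtains hσ.isSelector
  obtain ⟨y', hy'⟩ := exists_obtains hτ.isSelector
  have hg : d * z.1 + p * z.2 = g := by
    refine le_antisymm (hσ.cost_eq hy ▸ hsupp y hy.mem_obtainable) ?_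
    obtain ⟨x, hx, hzx⟩ := hz.1
    rw [hzx]
    exact gain_le hB hx
  have hseg' : ∀ y ∈ M.obtainable, d * y.1 + p * y.2 = g → y ∈ segment ℝ z w :=
    fun y hy hyg => hline y hy (hyg.trans hg.symm)
  have hrange : ∀ y ∈ segment ℝ z w, w.2 ≤ y.2 ∧ y.2 ≤ z.2 := by
    rintro _ ⟨a, b, ha, hb, hab, rfl⟩
    obtain rfl : a = 1 - b := by linarith
    simp only [Prod.snd_add, Prod.smul_snd, smul_eq_mul]
    constructor <;> nlinarith
  have heq : ∀ u v : ℝ × ℝ, d * u.1 + p * u.2 = g → d * v.1 + p * v.2 = g → u.2 = v.2 → u = v := by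
    intro u v hu hv huv
    refine Prod.ext (mul_left_cancel₀ hd.ne' ?_) huv
    rw [huv] at hu
    linarith
  -- A deterministic policy for `z` uses optimal rates on its support, none below `σ`, so its delay
  -- is at most that of `σ`; on the edge `z` has the largest delay.
  have hyz : y = z := by
    refine heq y z (hσ.cost_eq hy) hg (le_antisymm
      (hrange y (hseg' y hy.mem_obtainable (hσ.cost_eq hy))).2 ?_)
    obtain ⟨σz, hσz, uz, oz⟩ := exists_selector_of_extreme hz
    obtain ⟨π, hπ, hzπ⟩ := (Policy.obtains_iff _).1 oz
    obtain ⟨ρ, hρ, hyρ⟩ := (Policy.obtains_iff _).1 hy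
    rw [hzπ, hyρ]
    obtain ⟨i₀, hi₀⟩ := support_nonempty hπ
    refine snd_le_of_mean_queue_le (mean_queue_le hσz hσ.isSelector uz (hσ.isUnichain hμ)
      (absorbing_support hσz hπ) (absorbing_univ _) hi₀ (mem_univ i₀) rfl le_rfl
      (fun i hi j _ hij hle => ?_) hπ hρ)
    have h1 := hσ.rest_mono i j hij hle
    have h2 := Fin.le_def.1 (hmin i _ (isOptimal_of_obtains hσz hB hπ (hzπ ▸ hg) hi))
    omega
  -- Symmetrically, `τ` transmits at least as much as a policy for `w` does on its support, so its
  -- delay is at most that of `w`, the least on the edge.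
  have hyw : y' = w := by
    refine heq y' w (hτ.cost_eq hy') (hcw.trans hg) (le_antisymm ?_
      (hrange y' (hseg' y' hy'.mem_obtainable (hτ.cost_eq hy'))).1)
    obtain ⟨σw, hσw, uw, ow⟩ := exists_selector_of_extreme hw
    obtain ⟨π, hπ, hwπ⟩ := (Policy.obtains_iff _).1 ow
    obtain ⟨ρ, hρ, hyρ⟩ := (Policy.obtains_iff _).1 hy'
    have hgw := hcw.trans hg
    rw [hwπ] at hgw
    rw [hwπ, hyρ]
    obtain ⟨j₀, hj₀⟩ := support_nonempty hπ
    refine snd_le_of_mean_queue_le (mean_queue_le hτ.isSelector hσw (hτ.isUnichain hμ) uw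
      (absorbing_univ _) (absorbing_support hσw hπ) (mem_univ j₀) hj₀ rfl le_rfl
      (fun i _ j hj hij hle => ?_) hρ hπ)
    have h1 := hτ.rest_mono i j hij hle
    have h2 := Fin.le_def.1 (hmax j _ (isOptimal_of_obtains hσw hB hπ hgw hj))
    omega
  exact IsMonotoneOptimal.exists_chain hd hp hB hc hτ hmax (hyw ▸ hy') hseg' _ σ hσ z (hyz ▸ hy) rfl

end AWGNLink

theorem theorem3 (M : AWGNLink) :
    -- every vertex is obtained by a deterministic policy whose Markov chain is a unichain
    (∀ z ∈ M.vertices, ∃ F : M.Policy, F.IsDeterministic ∧ F.IsUnichain ∧ F.Obtains z) ∧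
    -- adjacent vertices, ordered by their power: the segment between them is an edge of the curve
    (∀ z ∈ M.vertices, ∀ w ∈ M.vertices, z.1 < w.1 → segment ℝ z w ⊆ M.curve →
      -- nondegenerate edge: the two policies differ in exactly one state
      ((∀ F : M.Policy, F.IsDeterministic → F.IsUnichain →
          ∀ v ∈ openSegment ℝ z w, ¬ F.Obtains v) → M.OneStateStep z w) ∧
      -- in general: a series of collinear points along the edge, consecutive ones of which are
      -- obtained by policies that differ in exactly one state
      (∃ (n : ℕ) (v : ℕ → ℝ × ℝ), v 0 = z ∧ v n = w ∧ (∀ k ≤ n, v k ∈ segment ℝ z w) ∧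
        ∀ k < n, (v k).1 < (v (k + 1)).1 ∧ M.OneStateStep (v k) (v (k + 1)))) := by
  refine ⟨fun z hz => ?_, fun z hz w hw hzw hseg => ?_⟩
  · obtain ⟨σ, hσ, u, o⟩ := AWGNLink.exists_selector_of_extreme (M.vertices_subset hz)
    exact ⟨_, AWGNLink.detPolicy_isDeterministic hσ, u, o⟩
  · have hchain := AWGNLink.exists_chain (M.vertices_subset hz) (M.vertices_subset hw) hzw hseg
    refine ⟨fun hno => ?_, hchain⟩
    obtain ⟨n, v, v0, vn, vseg, vstep⟩ := hchain
    rcases n with _ | n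
    · rw [v0] at vn
      exact absurd (congrArg Prod.fst vn) hzw.ne
    obtain ⟨hlt, hstep⟩ := vstep 0 (Nat.succ_pos n)
    rw [v0] at hlt hstep
    rw [zero_add] at hlt hstep
    suffices v 1 = w from this ▸ hstep
    by_contra hne
    obtain ⟨-, F, -, -, -, hF1, hF2, hF3, -⟩ := hstep
    exact hno F hF1 hF2 (v 1) (mem_openSegment_of_ne_left_right
      (fun e => hlt.ne (congrArg Prod.fst e)) (Ne.symm hne) (vseg 1 (by omega))) hF3
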